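/- Let $U$ be a random $4\times 4$ unitary matrix distributed according to the normalized Haar measure of $U(4)$ (the ensemble $\mathrm{CUE}_4$). Let $e^{i\varphi_1},\dots,e^{i\varphi_4}$ be its eigenvalues, with multiplicity, where $0\le\varphi_1\le\varphi_2\le\varphi_3\le\varphi_4<2\pi$, and let $$s_{\min}=\frac{4}{2\pi}\min\{\varphi_2-\varphi_1,\ \varphi_3-\varphi_2,\ \varphi_4-\varphi_3,\ 2\pi+\varphi_1-\varphi_4\}$$ be the minimal spacing between neighbouring eigenphases, normalized by the mean spacing $2\pi/4$. Define, for $s\in[0,1]$, $$\begin{aligned} P^U_4(s)=\frac{1}{72\pi^2}\sin^2\!\Big(\frac{\pi s}{4}\Big)\bigg(&666+720\pi^2(1-s)^2+36\big(11+16\pi^2(1-s)^2\big)\cos\frac{\pi s}{2}\\ &+18\big(8\pi^2(1-s)^2-13\big)\cos(\pi s)-100\cos\frac{3\pi s}{2}-608\cos(2\pi s)\\ &-380\cos\frac{5\pi s}{2}+234\cos(3\pi s)+74\cos\frac{7\pi s}{2}-58\cos(4\pi s)+10\cos\frac{9\pi s}{2}\\ &+24\pi(1-s)\Big[60\sin\frac{\pi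 s}{2}+63\sin(\pi s)+22\sin\frac{3\pi s}{2}+2\sin(2\pi s)-4\sin\frac{5\pi s}{2}\Big]\bigg). \end{aligned}$$ Then the random variable $s_{\min}$ takes values in $[0,1]$ almost surely and its law is absolutely continuous with density $P^U_4\ge 0$ on $[0,1]$ (and $0$ elsewhere). Moreover, the tail function $T(t)=\mathbb{P}(s_{\min}>t)$ is differentiable at every $t\in[0,1]$, with $-T'(t)=P^U_4(t)$. -/

import Mathlib

open MeasureTheory

namespace CUESpacing

/-! ### The circular unitary ensemble -/

noncomputable instance instMeasurableSpaceUnitaryGroup (N : ℕ) :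
    MeasurableSpace (Matrix.unitaryGroup (Fin N) ℂ) := borel _

instance instBorelSpaceUnitaryGroup (N : ℕ) :
    BorelSpace (Matrix.unitaryGroup (Fin N) ℂ) := ⟨rfl⟩

instance instCompactSpaceUnitaryGroup (N : ℕ) :
    CompactSpace (Matrix.unitaryGroup (Fin N) ℂ) := by
  have hsub : (Matrix.unitaryGroup (Fin N) ℂ : Set (Matrix (Fin N) (Fin N) ℂ)) ⊆
      Set.pi Set.univ fun _ => Set.pi Set.univ fun _ => Metric.closedBall (0 : ℂ) 1 := by
    intro U hU i _ j _
    simpa using entry_norm_bound_of_unitary hU i j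
  have hK : IsCompact (Set.pi Set.univ fun _ : Fin N => Set.pi Set.univ fun _ : Fin N =>
      Metric.closedBall (0 : ℂ) 1) :=
    isCompact_univ_pi fun _ => isCompact_univ_pi fun _ => isCompact_closedBall 0 1
  have hc : IsClosed (Matrix.unitaryGroup (Fin N) ℂ : Set (Matrix (Fin N) (Fin N) ℂ)) := by
    have : (Matrix.unitaryGroup (Fin N) ℂ : Set (Matrix (Fin N) (Fin N) ℂ)) =
        {U | U * star U = 1} := by
      ext U
      exact Matrix.mem_unitaryGroup_iff
    rw [this]
    exact isClosed_eq (continuous_id.mul continuous_star) continuous_const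
  exact isCompact_iff_compactSpace.mp (hK.of_isClosed_subset hc hsub)

/-- The circular unitary ensemble `CUE_N`: the Haar measure of the compact group `U(N)`,
normalized to total mass one. -/
noncomputable def cue (N : ℕ) : Measure (Matrix.unitaryGroup (Fin N) ℂ) :=
  Measure.haarMeasure ⊤

/-! ### Eigenphases and spacings -/

/-- The phase of `z`: for `|z| = 1`, the unique `φ ∈ [0, 2π)` with `z = exp (i φ)`. -/
noncomputable def phase (z : ℂ) : ℝ :=
  toIcoMod Real.two_pi_pos 0 z.arg

/-- The eigenphases of a matrix, listed in non-decreasing order and with algebraic multiplicity. -/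
noncomputable def eigenphaseList {N : ℕ} (A : Matrix (Fin N) (Fin N) ℂ) : List ℝ :=
  (A.charpoly.roots.map phase).sort (· ≤ ·)

theorem length_eigenphaseList {N : ℕ} (A : Matrix (Fin N) (Fin N) ℂ) :
    (eigenphaseList A).length = N := by
  simp [eigenphaseList, ← (IsAlgClosed.splits A.charpoly).natDegree_eq_card_roots]

/-- The eigenphases `φ_0 ≤ φ_1 ≤ … ≤ φ_{N-1}` in `[0, 2π)`. -/
noncomputable def eigenphase {N : ℕ} (A : Matrix (Fin N) (Fin N) ℂ) (j : Fin N) : ℝ :=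
  (eigenphaseList A).get (Fin.cast (length_eigenphaseList A).symm j)

/-- The spacing between the eigenphase number `j` and the next one on the circle:
`φ_{j+1} - φ_j` for `j + 1 < N`, and `2π + φ_0 - φ_{N-1}` for `j = N - 1`. -/
noncomputable def gap {N : ℕ} (A : Matrix (Fin N) (Fin N) ℂ) (j : Fin N) : ℝ :=
  if h : (j : ℕ) + 1 < N then eigenphase A ⟨j + 1, h⟩ - eigenphase A j
  else 2 * Real.pi + eigenphase A ⟨0, j.pos⟩ - eigenphase A j

/-- The minimal spacing `s_min`, in units of the mean spacing `2π / N`. -/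
noncomputable def sMin {N : ℕ} [NeZero N] (A : Matrix (Fin N) (Fin N) ℂ) : ℝ :=
  Finset.univ.inf' Finset.univ_nonempty fun j => gap A j / (2 * Real.pi / N)

/-! ### The explicit density -/

open Real in
/-- The explicit expression for the density of the minimal spacing of `CUE_4`. -/
noncomputable def densityCUE4 (s : ℝ) : ℝ :=
  1 / (72 * π ^ 2) * sin (π * s / 4) ^ 2 *
    (666 + 720 * π ^ 2 * (1 - s) ^ 2
      + 36 * (11 + 16 * π ^ 2 * (1 - s) ^ 2) * cos (π * s / 2)
      + 18 * (8 * π ^ 2 * (1 - s) ^ 2 - 13) * cos (π * s)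
      - 100 * cos (3 * π * s / 2) - 608 * cos (2 * π * s)
      - 380 * cos (5 * π * s / 2) + 234 * cos (3 * π * s)
      + 74 * cos (7 * π * s / 2) - 58 * cos (4 * π * s)
      + 10 * cos (9 * π * s / 2)
      + 24 * π * (1 - s) *
        (60 * sin (π * s / 2) + 63 * sin (π * s) + 22 * sin (3 * π * s / 2)
          + 2 * sin (2 * π * s) - 4 * sin (5 * π * s / 2)))

end CUESpacing

/-!
Haar invariance on `U(N)` gives, for every trace polynomial `F`, the loop (Schwinger–Dyson)
equation: the expectation of the Laplacian of `F` vanishes. On eigenvalues, conjugation by the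
Vandermonde product turns this Laplacian into the flat Laplacian of the torus, up to the constant
ground-state energy. Since `Δ · F` is antisymmetric, the Laplacian then determines the expectation
of `F` by its lowest antisymmetric mode, which is the Vandermonde product itself: this is Weyl's
integration formula for power sums, and hence for the law of the ordered eigenphases.

For `N = 4`, pass to the gaps of the ordered eigenphases. Integrating out the rotation weights a
configuration by its last gap. The gap density is invariant under cyclic permutations of the gaps
and the four gaps add up to `2π`, so this weight may be traded for `2π` times the restriction to
configurations whose first gap is the smallest. The remaining integral over two free gaps is a
trigonometric one with an explicit primitive.
-/

namespace CUESpacing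

/-! ### Signed sums over integer intervals -/

section SignedSum

variable {M : Type*} [AddCommGroup M]

/-- The sum of `B 1, …, B k` for `k ≥ 0`, and minus the sum of `B (k + 1), …, B 0` for `k ≤ 0`. -/
noncomputable def signedSum (k : ℤ) (B : ℤ → M) : M :=
  ∑ a ∈ Finset.Ioc 0 k, B a - ∑ a ∈ Finset.Ioc k 0, B a

@[simp]
theorem signedSum_zero (B : ℤ → M) : signedSum 0 B = 0 := by
  simp [signedSum]

theorem signedSum_add_one (k : ℤ) (B : ℤ → M) :
    signedSum (k + 1) B = signedSum k B + B (k + 1) := by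
  unfold signedSum
  rcases le_or_gt 0 k with hk | hk
  · have hinsert : Finset.Ioc 0 (k + 1) = insert (k + 1) (Finset.Ioc 0 k) := by
      ext a; simp only [Finset.mem_Ioc, Finset.mem_insert]; omega
    have hempty : Finset.Ioc k 0 = ∅ := Finset.Ioc_eq_empty (by omega)
    have hempty' : Finset.Ioc (k + 1) 0 = ∅ := Finset.Ioc_eq_empty (by omega)
    rw [hinsert, hempty, hempty', Finset.sum_insert (by simp)]
    simp only [Finset.sum_empty]; abel
  · have hinsert : Finset.Ioc k 0 = insert (k + 1) (Finset.Ioc (k + 1) 0) := by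
      ext a; simp only [Finset.mem_Ioc, Finset.mem_insert]; omega
    have hempty : Finset.Ioc 0 k = ∅ := Finset.Ioc_eq_empty (by omega)
    have hempty' : Finset.Ioc 0 (k + 1) = ∅ := Finset.Ioc_eq_empty (by omega)
    rw [hinsert, hempty, hempty', Finset.sum_insert (by simp)]
    simp only [Finset.sum_empty]; abel

theorem signedSum_sub_one (k : ℤ) (B : ℤ → M) :
    signedSum (k - 1) B = signedSum k B - B k := by
  have := signedSum_add_one (k - 1) B
  rw [sub_add_cancel] at this
  rw [this]; abel

theorem map_signedSum {M' F : Type*} [AddCommGroup M'] [FunLike F M M'] [AddMonoidHomClass F M M']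
    (f : F) (k : ℤ) (B : ℤ → M) : f (signedSum k B) = signedSum k fun a => f (B a) := by
  simp [signedSum, map_sum]

theorem signedSum_sum {ι : Type*} (s : Finset ι) (k : ℤ) (B : ι → ℤ → M) :
    signedSum k (fun a => ∑ i ∈ s, B i a) = ∑ i ∈ s, signedSum k (B i) := by
  simp only [signedSum, Finset.sum_sub_distrib]
  rw [Finset.sum_comm, Finset.sum_comm (s := Finset.Ioc k 0)]

theorem signedSum_const (k : ℤ) (b : M) : signedSum k (fun _ => b) = k • b := by
  induction k using Int.induction_on with
  | zero => simp
  | succ n ih => rw [signedSum_add_one, ih, add_smul, one_smul]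
  | pred n ih => rw [signedSum_sub_one, ih, sub_smul, one_smul]

theorem signedSum_telescope (k : ℤ) (f : ℤ → M) :
    signedSum k (fun a => f (a + 1) - f a) = f (k + 1) - f 1 := by
  induction k using Int.induction_on with
  | zero => simp
  | succ n ih => rw [signedSum_add_one, ih]; abel
  | pred n ih => rw [signedSum_sub_one, ih, sub_add_cancel]; abel

end SignedSum

/-! ### The polynomial algebra of power traces -/

/-- Polynomials in formal variables `X k`, standing for the power traces `tr (U ^ k)`, `k : ℤ`. -/
abbrev TracePoly := MvPolynomial ℤ ℂ

/-- The total derivative of a trace polynomial, as the family of its partial derivatives. -/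
noncomputable def grad : Derivation ℂ TracePoly (ℤ →₀ TracePoly) :=
  MvPolynomial.mkDerivation ℂ fun k => Finsupp.single k 1

theorem grad_X (k : ℤ) : grad (MvPolynomial.X k : TracePoly) = Finsupp.single k 1 :=
  MvPolynomial.mkDerivation_X ℂ _ k

theorem grad_X_mul (k : ℤ) (f : TracePoly) :
    grad (MvPolynomial.X k * f) = (MvPolynomial.X k : TracePoly) • grad f + Finsupp.single k f := by
  rw [Derivation.leibniz, grad_X, Finsupp.smul_single, smul_eq_mul, mul_one]

/-- The polynomial `X 1 * X (k - 1) + … + X k * X 0`, with the signed convention for `k < 0`. -/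
noncomputable def loopSum (k : ℤ) : TracePoly :=
  signedSum k fun a => MvPolynomial.X a * MvPolynomial.X (k - a)

/-- The linear map sending a family `h` to `∑ l, l * X (k + l) * h l`. -/
noncomputable def loopContract (k : ℤ) : (ℤ →₀ TracePoly) →ₗ[TracePoly] TracePoly :=
  Finsupp.lsum TracePoly fun l => LinearMap.lsmul TracePoly TracePoly
    ((l : TracePoly) * MvPolynomial.X (k + l))

theorem loopContract_single (k l : ℤ) (f : TracePoly) :
    loopContract k (Finsupp.single l f) = (l : TracePoly) * MvPolynomial.X (k + l) * f := by
  simp [loopContract]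

/-- The Schwinger–Dyson operator: the divergence of `U ^ k * g` on the unitary group. -/
noncomputable def loopOp (k : ℤ) : TracePoly →ₗ[ℂ] TracePoly :=
  LinearMap.mulLeft ℂ (loopSum k) +
    (loopContract k).restrictScalars ℂ ∘ₗ (grad : TracePoly →ₗ[ℂ] (ℤ →₀ TracePoly))

theorem loopOp_apply (k : ℤ) (g : TracePoly) :
    loopOp k g = loopSum k * g + loopContract k (grad g) := by
  simp [loopOp]

/-! ### Integration by parts on the unitary group -/

theorem integral_eq_zero_of_hasDerivAt_mul {G E : Type*} [TopologicalSpace G] [Group G]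
    [IsTopologicalGroup G] [CompactSpace G] [MeasurableSpace G] [BorelSpace G] {μ : Measure G}
    [IsFiniteMeasure μ] [μ.IsMulRightInvariant] [NormedAddCommGroup E] [NormedSpace ℝ E]
    [SecondCountableTopologyEither G E] {γ : ℝ → G} {f f' : G → E} (hf : Continuous f)
    (hf' : Continuous f')
    (hderiv : ∀ g t, HasDerivAt (fun s => f (g * γ s)) (f' (g * γ t)) t) :
    ∫ g, f' g ∂μ = 0 := by
  obtain ⟨C, hC⟩ := (isCompact_range hf').isBounded.exists_norm_le
  have hint : HasDerivAt (fun t => ∫ g, f (g * γ t) ∂μ) (∫ g, f' (g * γ 0) ∂μ) 0 :=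
    (hasDerivAt_integral_of_dominated_loc_of_deriv_le (F := fun t g => f (g * γ t))
      (F' := fun t g => f' (g * γ t)) (bound := fun _ => C) Filter.univ_mem
      (Filter.Eventually.of_forall fun t =>
        (hf.comp (continuous_mul_const (γ t))).aestronglyMeasurable)
      ((hf.comp (continuous_mul_const (γ 0))).integrable_of_hasCompactSupport
        (HasCompactSupport.of_compactSpace _))
      (hf'.comp (continuous_mul_const (γ 0))).aestronglyMeasurable
      (ae_of_all _ fun g t _ => hC _ (Set.mem_range_self _)) (integrable_const C)
      (ae_of_all _ fun g t _ => hderiv g t)).2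
  simp only [integral_mul_right_eq_self] at hint
  exact hint.unique (hasDerivAt_const _ _)

section Haar

variable {N : ℕ}

/-- The power traces of a unitary matrix. -/
noncomputable def powTrace (U : Matrix.unitaryGroup (Fin N) ℂ) (k : ℤ) : ℂ :=
  Matrix.trace ((U ^ k : Matrix.unitaryGroup (Fin N) ℂ) : Matrix (Fin N) (Fin N) ℂ)

/-- The derivative of `U ^ k` when `U` moves with velocity `U * X`. -/
noncomputable def powDeriv (U : Matrix.unitaryGroup (Fin N) ℂ) (k : ℤ) :
    Matrix (Fin N) (Fin N) ℂ →ₗ[ℂ] Matrix (Fin N) (Fin N) ℂ :=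
  signedSum k fun a => LinearMap.mulLeftRight ℂ ((U ^ a).1, (U ^ (k - a)).1)

theorem powDeriv_apply (U : Matrix.unitaryGroup (Fin N) ℂ) (k : ℤ)
    (X : Matrix (Fin N) (Fin N) ℂ) :
    powDeriv U k X = signedSum k fun a => (U ^ a).1 * X * (U ^ (k - a)).1 := by
  have := map_signedSum (LinearMap.applyₗ (R := ℂ) X) k
    fun a => LinearMap.mulLeftRight ℂ ((U ^ a).1, (U ^ (k - a)).1)
  simpa [powDeriv] using this

theorem trace_powDeriv (U : Matrix.unitaryGroup (Fin N) ℂ) (k : ℤ)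
    (X : Matrix (Fin N) (Fin N) ℂ) :
    (powDeriv U k X).trace = k * ((U ^ k).1 * X).trace := by
  have h : ∀ a, ((U ^ a).1 * X * (U ^ (k - a)).1).trace = ((U ^ k).1 * X).trace := by
    intro a
    rw [Matrix.trace_mul_comm, ← mul_assoc, ← Submonoid.coe_mul, ← zpow_add, sub_add_cancel]
  rw [powDeriv_apply, ← Matrix.traceAddMonoidHom_apply, map_signedSum]
  simp only [Matrix.traceAddMonoidHom_apply, h, signedSum_const, zsmul_eq_mul]

/-- The derivative of a trace polynomial when `U` moves with velocity `U * X`. -/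
noncomputable def traceDeriv (U : Matrix.unitaryGroup (Fin N) ℂ) (X : Matrix (Fin N) (Fin N) ℂ)
    (h : ℤ →₀ TracePoly) : ℂ :=
  h.sum fun l q => l * ((U ^ l).1 * X).trace * MvPolynomial.eval (powTrace U) q

theorem traceDeriv_single (U : Matrix.unitaryGroup (Fin N) ℂ) (X : Matrix (Fin N) (Fin N) ℂ)
    (l : ℤ) (q : TracePoly) :
    traceDeriv U X (Finsupp.single l q) =
      l * ((U ^ l).1 * X).trace * MvPolynomial.eval (powTrace U) q := by
  simp [traceDeriv]

theorem traceDeriv_add (U : Matrix.unitaryGroup (Fin N) ℂ) (X : Matrix (Fin N) (Fin N) ℂ)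
    (h h' : ℤ →₀ TracePoly) : traceDeriv U X (h + h') = traceDeriv U X h + traceDeriv U X h' :=
  Finsupp.sum_add_index' (by simp) (by simp [mul_add])

theorem traceDeriv_smul (U : Matrix.unitaryGroup (Fin N) ℂ) (X : Matrix (Fin N) (Fin N) ℂ)
    (p : TracePoly) (h : ℤ →₀ TracePoly) :
    traceDeriv U X (p • h) = MvPolynomial.eval (powTrace U) p * traceDeriv U X h := by
  simp only [traceDeriv]
  rw [Finsupp.sum_smul_index' (by simp), Finsupp.mul_sum]
  refine Finsupp.sum_congr fun l _ => ?_
  simp only [smul_eq_mul, map_mul]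
  ring

section Curve

open scoped Matrix.Norms.Operator

theorem hasDerivAt_zpow_of_hasDerivAt {W : ℝ → Matrix.unitaryGroup (Fin N) ℂ}
    {X : Matrix (Fin N) (Fin N) ℂ} {t : ℝ}
    (hW : HasDerivAt (fun s => (W s).1) ((W t).1 * X) t)
    (hW' : HasDerivAt (fun s => ((W s)⁻¹).1) (-(X * ((W t)⁻¹).1)) t) (k : ℤ) :
    HasDerivAt (fun s => (W s ^ k).1) (powDeriv (W t) k X) t := by
  simp only [powDeriv_apply]
  induction k using Int.induction_on with
  | zero =>
    simp only [zpow_zero, OneMemClass.coe_one, signedSum_zero]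
    exact hasDerivAt_const t (1 : Matrix (Fin N) (Fin N) ℂ)
  | succ n ih =>
    have := ih.mul hW
    simp only [Pi.mul_def, ← Submonoid.coe_mul, ← zpow_add_one] at this
    refine this.congr_deriv ?_
    rw [signedSum_add_one, sub_self, zpow_zero, OneMemClass.coe_one, mul_one, ← mul_assoc,
      ← Submonoid.coe_mul, ← zpow_add_one, ← AddMonoidHom.mulRight_apply, map_signedSum]
    simp only [AddMonoidHom.mulRight_apply, mul_assoc, ← Submonoid.coe_mul, ← zpow_add_one]
    simp only [sub_add_eq_add_sub]
  | pred n ih =>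
    have := ih.mul hW'
    simp only [Pi.mul_def, ← Submonoid.coe_mul, ← zpow_sub_one] at this
    refine this.congr_deriv ?_
    rw [signedSum_sub_one, ← AddMonoidHom.mulRight_apply, map_signedSum]
    simp only [AddMonoidHom.mulRight_apply, mul_assoc, ← Submonoid.coe_mul, ← zpow_sub_one]
    simp only [sub_right_comm, sub_self, zero_sub, zpow_neg_one, mul_neg, ← sub_eq_add_neg]

theorem hasDerivAt_linearMap_comp {E : Type*} [NormedAddCommGroup E] [NormedSpace ℂ E]
    [FiniteDimensional ℂ E] (L : E →ₗ[ℂ] ℂ) {f : ℝ → E} {f' : E} {t : ℝ}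
    (hf : HasDerivAt f f' t) : HasDerivAt (fun s => L (f s)) (L f') t :=
  ((L.toContinuousLinearMap.restrictScalars ℝ).hasFDerivAt.comp_hasDerivAt t hf :)

theorem hasDerivAt_eval_powTrace {W : ℝ → Matrix.unitaryGroup (Fin N) ℂ}
    {X : Matrix (Fin N) (Fin N) ℂ} {t : ℝ}
    (hW : HasDerivAt (fun s => (W s).1) ((W t).1 * X) t)
    (hW' : HasDerivAt (fun s => ((W s)⁻¹).1) (-(X * ((W t)⁻¹).1)) t) (g : TracePoly) :
    HasDerivAt (fun s => MvPolynomial.eval (powTrace (W s)) g) (traceDeriv (W t) X (grad g)) t := by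
  induction g using MvPolynomial.induction_on with
  | C a => simpa [traceDeriv] using hasDerivAt_const t a
  | add p q hp hq =>
    simp only [map_add, traceDeriv_add]
    exact hp.add hq
  | mul_X p k hp =>
    have hk : HasDerivAt (fun s => powTrace (W s) k) (k * ((W t ^ k).1 * X).trace) t := by
      have := hasDerivAt_linearMap_comp (Matrix.traceLinearMap (Fin N) ℂ ℂ)
        (hasDerivAt_zpow_of_hasDerivAt hW hW' k)
      simp only [Matrix.traceLinearMap_apply, trace_powDeriv] at this
      exact this
    simp only [map_mul, MvPolynomial.eval_X]
    refine (hp.mul hk).congr_deriv ?_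
    rw [mul_comm p, grad_X_mul, traceDeriv_add, traceDeriv_smul, MvPolynomial.eval_X,
      traceDeriv_single]
    ring

/-- The one-parameter subgroup generated by a skew-Hermitian matrix. -/
noncomputable def expCurve (X : Matrix (Fin N) (Fin N) ℂ) (hX : star X = -X) (t : ℝ) :
    Matrix.unitaryGroup (Fin N) ℂ :=
  ⟨NormedSpace.exp (t • X), by
    rw [Matrix.mem_unitaryGroup_iff, Matrix.star_eq_conjTranspose, ← Matrix.exp_conjTranspose,
      Matrix.conjTranspose_smul, ← Matrix.star_eq_conjTranspose X, hX]
    have h := Matrix.exp_add_of_commute (t • X) (-(t • X)) (Commute.refl (t • X)).neg_right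
    rw [star_trivial, smul_neg, ← h, add_neg_cancel, NormedSpace.exp_zero]⟩

theorem coe_inv_expCurve (X : Matrix (Fin N) (Fin N) ℂ) (hX : star X = -X) (t : ℝ) :
    ((expCurve X hX t)⁻¹).1 = NormedSpace.exp (t • (-X)) := by
  have : ((expCurve X hX t)⁻¹).1 = star (NormedSpace.exp (t • X)) := rfl
  rw [this, Matrix.star_eq_conjTranspose, ← Matrix.exp_conjTranspose,
    Matrix.conjTranspose_smul, ← Matrix.star_eq_conjTranspose X, hX, star_trivial]

theorem hasDerivAt_mul_expCurve (U : Matrix.unitaryGroup (Fin N) ℂ)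
    (X : Matrix (Fin N) (Fin N) ℂ) (hX : star X = -X) (t : ℝ) :
    HasDerivAt (fun s => (U * expCurve X hX s).1) ((U * expCurve X hX t).1 * X) t := by
  have := (hasDerivAt_exp_smul_const (𝕂 := ℝ) X t).const_mul U.1
  simp only [← mul_assoc] at this
  exact this

theorem hasDerivAt_inv_mul_expCurve (U : Matrix.unitaryGroup (Fin N) ℂ)
    (X : Matrix (Fin N) (Fin N) ℂ) (hX : star X = -X) (t : ℝ) :
    HasDerivAt (fun s => ((U * expCurve X hX s)⁻¹).1)
      (-(X * ((U * expCurve X hX t)⁻¹).1)) t := by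
  have := (hasDerivAt_exp_smul_const' (𝕂 := ℝ) (-X) t).mul_const ((U⁻¹).1)
  simp only [mul_assoc, neg_mul] at this
  simp only [mul_inv_rev, Submonoid.coe_mul, coe_inv_expCurve]
  exact this

instance isProbabilityMeasure_cue : IsProbabilityMeasure (cue N) :=
  ⟨Measure.haarMeasure_self
    (K₀ := (⊤ : TopologicalSpace.PositiveCompacts (Matrix.unitaryGroup (Fin N) ℂ)))⟩

instance isHaarMeasure_cue : (cue N).IsHaarMeasure := by
  unfold cue; infer_instance

instance isMulRightInvariant_cue : (cue N).IsMulRightInvariant := by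
  refine ⟨fun g => ?_⟩
  have : IsProbabilityMeasure (Measure.map (· * g) (cue N)) :=
    Measure.isProbabilityMeasure_map (measurable_mul_const g).aemeasurable
  exact Measure.isHaarMeasure_eq_of_isProbabilityMeasure _ _

theorem continuous_coe_zpow (k : ℤ) :
    Continuous fun U : Matrix.unitaryGroup (Fin N) ℂ => (U ^ k).1 :=
  continuous_subtype_val.comp (continuous_zpow k)

theorem continuous_eval_powTrace (g : TracePoly) :
    Continuous fun U : Matrix.unitaryGroup (Fin N) ℂ => MvPolynomial.eval (powTrace U) g :=
  (MvPolynomial.continuous_eval g).comp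
    (continuous_pi fun k => (continuous_coe_zpow k).matrix_trace)

theorem integrable_cue_of_continuous {f : Matrix.unitaryGroup (Fin N) ℂ → ℂ} (hf : Continuous f) :
    Integrable f (cue N) :=
  hf.integrable_of_hasCompactSupport (HasCompactSupport.of_compactSpace f)

/-- The derivative of the function `(U ^ k) i j * g U` when `U` moves with velocity `U * X`. -/
noncomputable def entryDeriv (k : ℤ) (g : TracePoly) (i j : Fin N)
    (X : Matrix (Fin N) (Fin N) ℂ) (U : Matrix.unitaryGroup (Fin N) ℂ) : ℂ :=
  powDeriv U k X i j * MvPolynomial.eval (powTrace U) g + (U ^ k).1 i j * traceDeriv U X (grad g)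

theorem continuous_entryDeriv (k : ℤ) (g : TracePoly) (i j : Fin N)
    (X : Matrix (Fin N) (Fin N) ℂ) : Continuous (entryDeriv k g i j X) := by
  have hpow : Continuous fun U : Matrix.unitaryGroup (Fin N) ℂ => powDeriv U k X := by
    simp only [powDeriv_apply, signedSum]
    refine Continuous.sub ?_ ?_ <;> refine continuous_finsetSum _ fun a _ => ?_ <;>
      exact ((continuous_coe_zpow a).matrix_mul continuous_const).matrix_mul
        (continuous_coe_zpow (k - a))
  have htrace : Continuous fun U : Matrix.unitaryGroup (Fin N) ℂ => traceDeriv U X (grad g) := by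
    refine continuous_finsetSum _ fun l _ => ?_
    exact (continuous_const.mul ((continuous_coe_zpow l).matrix_mul
      continuous_const).matrix_trace).mul (continuous_eval_powTrace _)
  exact ((hpow.matrix_elem i j).mul (continuous_eval_powTrace g)).add
    (((continuous_coe_zpow k).matrix_elem i j).mul htrace)

theorem integral_entryDeriv_of_star_eq_neg (k : ℤ) (g : TracePoly) (i j : Fin N)
    (X : Matrix (Fin N) (Fin N) ℂ) (hX : star X = -X) :
    ∫ U, entryDeriv k g i j X U ∂(cue N) = 0 := by
  have hcont : Continuous fun U : Matrix.unitaryGroup (Fin N) ℂ =>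
      (U ^ k).1 i j * MvPolynomial.eval (powTrace U) g :=
    ((continuous_coe_zpow k).matrix_elem i j).mul (continuous_eval_powTrace g)
  refine integral_eq_zero_of_hasDerivAt_mul (γ := expCurve X hX) hcont
    (continuous_entryDeriv k g i j X) fun U t => ?_
  have hmul := hasDerivAt_mul_expCurve U X hX t
  have hinv := hasDerivAt_inv_mul_expCurve U X hX t
  exact (hasDerivAt_linearMap_comp (Matrix.entryLinearMap ℂ ℂ i j)
    (hasDerivAt_zpow_of_hasDerivAt hmul hinv k)).mul (hasDerivAt_eval_powTrace hmul hinv g)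

end Curve

theorem traceDeriv_smul_right (U : Matrix.unitaryGroup (Fin N) ℂ) (c : ℂ)
    (X : Matrix (Fin N) (Fin N) ℂ) (h : ℤ →₀ TracePoly) :
    traceDeriv U (c • X) h = c * traceDeriv U X h := by
  simp only [traceDeriv, Finsupp.mul_sum]
  refine Finsupp.sum_congr fun l _ => ?_
  rw [mul_smul_comm, Matrix.trace_smul, smul_eq_mul]
  ring

theorem entryDeriv_add (k : ℤ) (g : TracePoly) (i j : Fin N) (X Y : Matrix (Fin N) (Fin N) ℂ)
    (U : Matrix.unitaryGroup (Fin N) ℂ) :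
    entryDeriv k g i j (X + Y) U = entryDeriv k g i j X U + entryDeriv k g i j Y U := by
  simp only [entryDeriv, traceDeriv, map_add, Matrix.add_apply, mul_add, Matrix.trace_add, add_mul,
    Finsupp.sum_add]
  ring

theorem entryDeriv_smul (k : ℤ) (g : TracePoly) (i j : Fin N) (c : ℂ)
    (X : Matrix (Fin N) (Fin N) ℂ) (U : Matrix.unitaryGroup (Fin N) ℂ) :
    entryDeriv k g i j (c • X) U = c * entryDeriv k g i j X U := by
  simp only [entryDeriv, traceDeriv_smul_right, map_smul, Matrix.smul_apply, smul_eq_mul]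
  ring

theorem integral_entryDeriv (k : ℤ) (g : TracePoly) (i j : Fin N)
    (X : Matrix (Fin N) (Fin N) ℂ) : ∫ U, entryDeriv k g i j X U ∂(cue N) = 0 := by
  have hdec : X = (2⁻¹ : ℂ) • (X - star X) +
      (-(2⁻¹ * Complex.I)) • (Complex.I • (X + star X)) := by
    rw [smul_smul, neg_mul, mul_assoc, Complex.I_mul_I, smul_sub, smul_add]
    module
  have hskew_sub : star (X - star X) = -(X - star X) := by rw [star_sub, star_star]; abel
  have hskew_add : star (Complex.I • (X + star X)) = -(Complex.I • (X + star X)) := by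
    rw [star_smul, star_add, star_star, add_comm (star X), ← neg_smul]
    simp only [Complex.star_def, Complex.conj_I]
  rw [hdec]
  simp only [entryDeriv_add _ _ _ _ ((2⁻¹ : ℂ) • (X - star X)), entryDeriv_smul _ _ _ _ 2⁻¹,
    entryDeriv_smul _ _ _ _ (-(2⁻¹ * Complex.I))]
  rw [integral_add, integral_const_mul, integral_const_mul,
    integral_entryDeriv_of_star_eq_neg _ _ _ _ _ hskew_sub,
    integral_entryDeriv_of_star_eq_neg _ _ _ _ _ hskew_add, mul_zero, mul_zero, add_zero]
  · exact (integrable_cue_of_continuous (continuous_entryDeriv _ _ _ _ _)).const_mul _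
  · exact (integrable_cue_of_continuous (continuous_entryDeriv _ _ _ _ _)).const_mul _

theorem sum_powDeriv_single (k : ℤ) (U : Matrix.unitaryGroup (Fin N) ℂ) :
    ∑ i, ∑ j, powDeriv U k (Matrix.single i j 1) i j =
      MvPolynomial.eval (powTrace U) (loopSum k) := by
  have hentry : ∀ i j, powDeriv U k (Matrix.single i j 1) i j =
      signedSum k fun a => (U ^ a).1 i i * (U ^ (k - a)).1 j j := by
    intro i j
    have := map_signedSum (Matrix.entryLinearMap ℂ ℂ i j) k
      fun a => (U ^ a).1 * Matrix.single i j 1 * (U ^ (k - a)).1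
    rw [powDeriv_apply]
    refine this.trans (congrArg _ (funext fun a => ?_))
    simp only [Matrix.entryLinearMap_apply, Matrix.mul_apply, Matrix.single_apply, ite_and,
      mul_ite, mul_one, mul_zero, Finset.sum_ite_eq, Finset.mem_univ, if_true, ite_mul, zero_mul]
  simp only [hentry, loopSum, ← signedSum_sum, map_signedSum, map_mul, MvPolynomial.eval_X,
    powTrace, Matrix.trace, Matrix.diag, Finset.sum_mul_sum]

theorem sum_mul_traceDeriv_single (k : ℤ) (h : ℤ →₀ TracePoly)
    (U : Matrix.unitaryGroup (Fin N) ℂ) :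
    ∑ i, ∑ j, (U ^ k).1 i j * traceDeriv U (Matrix.single i j 1) h =
      MvPolynomial.eval (powTrace U) (loopContract k h) := by
  simp only [traceDeriv, loopContract, Finsupp.lsum_apply, Finsupp.sum, map_sum, Finset.mul_sum]
  rw [Finset.sum_congr rfl fun i _ => Finset.sum_comm, Finset.sum_comm]
  refine Finset.sum_congr rfl fun l _ => ?_
  have htrace : powTrace U (k + l) = ∑ i, ∑ j, (U ^ k).1 i j * (U ^ l).1 j i := by
    rw [powTrace, zpow_add, Submonoid.coe_mul]
    simp [Matrix.trace, Matrix.mul_apply]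
  simp only [LinearMap.lsmul_apply, smul_eq_mul, map_mul, MvPolynomial.eval_X, map_intCast, htrace,
    Matrix.trace_mul_single, Finset.mul_sum, Finset.sum_mul]
  refine Finset.sum_congr rfl fun i _ => Finset.sum_congr rfl fun j _ => ?_
  simp only [MulOpposite.op_one, one_smul]
  ring

theorem sum_entryDeriv (k : ℤ) (g : TracePoly) (U : Matrix.unitaryGroup (Fin N) ℂ) :
    ∑ i, ∑ j, entryDeriv k g i j (Matrix.single i j 1) U =
      MvPolynomial.eval (powTrace U) (loopOp k g) := by
  rw [loopOp_apply, map_add, map_mul, ← sum_powDeriv_single, ← sum_mul_traceDeriv_single]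
  simp only [entryDeriv, Finset.sum_add_distrib, Finset.sum_mul]

theorem integral_loopOp (k : ℤ) (g : TracePoly) :
    ∫ U, MvPolynomial.eval (powTrace U) (loopOp k g) ∂(cue N) = 0 := by
  have hInt : ∀ i j : Fin N, Integrable (entryDeriv k g i j (Matrix.single i j 1)) (cue N) :=
    fun i j => integrable_cue_of_continuous (continuous_entryDeriv _ _ _ _ _)
  simp only [← sum_entryDeriv]
  rw [integral_finsetSum _ fun i _ => integrable_finsetSum _ fun j _ => hInt i j]
  refine Finset.sum_eq_zero fun i _ => ?_
  rw [integral_finsetSum _ fun j _ => hInt i j]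
  exact Finset.sum_eq_zero fun j _ => integral_entryDeriv _ _ _ _ _

end Haar

/-! ### The Laplacian on trace polynomials -/

/-- The linear map sending a family `h` to `∑ k, k • loopOp k (h k)`. -/
noncomputable def loopSumOp : (ℤ →₀ TracePoly) →ₗ[ℂ] TracePoly :=
  Finsupp.lsum ℂ fun k : ℤ => (k : ℂ) • loopOp k

theorem loopSumOp_single (k : ℤ) (f : TracePoly) :
    loopSumOp (Finsupp.single k f) = (k : TracePoly) * loopOp k f := by
  rw [loopSumOp, Finsupp.lsum_single, LinearMap.smul_apply, MvPolynomial.smul_eq_C_mul, map_intCast]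

theorem loopSumOp_X_smul (k : ℤ) (h : ℤ →₀ TracePoly) :
    loopSumOp ((MvPolynomial.X k : TracePoly) • h) =
      MvPolynomial.X k * loopSumOp h + (k : TracePoly) * loopContract k h := by
  induction h using Finsupp.induction_linear with
  | zero => simp
  | add a b ha hb => rw [smul_add, map_add, ha, hb, map_add, map_add]; ring
  | single l q =>
    rw [Finsupp.smul_single, loopSumOp_single, loopSumOp_single, loopContract_single,
      loopOp_apply, loopOp_apply, smul_eq_mul, grad_X_mul, map_add, map_smul,
      loopContract_single, add_comm k l, smul_eq_mul]
    ring

/-- The Laplacian of the unitary group, acting on trace polynomials. -/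
noncomputable def laplacian : TracePoly →ₗ[ℂ] TracePoly :=
  loopSumOp ∘ₗ (grad : TracePoly →ₗ[ℂ] (ℤ →₀ TracePoly))

theorem laplacian_apply (f : TracePoly) : laplacian f = loopSumOp (grad f) :=
  rfl

theorem integral_laplacian {N : ℕ} (f : TracePoly) :
    ∫ U, MvPolynomial.eval (powTrace U) (laplacian f) ∂(cue N) = 0 := by
  simp only [laplacian_apply, loopSumOp, Finsupp.lsum_apply, Finsupp.sum, map_sum,
    LinearMap.smul_apply, MvPolynomial.smul_eval]
  rw [integral_finsetSum _ fun k _ =>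
    (integrable_cue_of_continuous (continuous_eval_powTrace _)).const_mul _]
  refine Finset.sum_eq_zero fun k _ => ?_
  rw [integral_const_mul, integral_loopOp, mul_zero]

theorem laplacian_C (a : ℂ) : laplacian (MvPolynomial.C a) = 0 := by
  simp [laplacian_apply]

theorem laplacian_X_mul (k : ℤ) (f : TracePoly) :
    laplacian (MvPolynomial.X k * f) = MvPolynomial.X k * laplacian f +
      (k : TracePoly) * loopSum k * f + 2 * (k : TracePoly) * loopContract k (grad f) := by
  rw [laplacian_apply, laplacian_apply, grad_X_mul, map_add, loopSumOp_X_smul, loopSumOp_single,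
    loopOp_apply]
  ring

/-! ### Laurent polynomials -/

/-- Laurent polynomials in `N` variables `u_0, …, u_{N-1}`. -/
abbrev Laurent (N : ℕ) := AddMonoidAlgebra ℂ (Fin N → ℤ)

namespace Laurent

section Operators

variable {N : ℕ}

/-- The operator multiplying the coefficient of the monomial `u ^ m` by `h m`. -/
noncomputable def diagOp (h : (Fin N → ℤ) → ℂ) : Laurent N →ₗ[ℂ] Laurent N :=
  (Finsupp.lsum ℂ fun m => h m • AddMonoidAlgebra.lsingle m) ∘ₗ
    (AddMonoidAlgebra.coeffLinearEquiv ℂ).toLinearMap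

theorem diagOp_single (h : (Fin N → ℤ) → ℂ) (m : Fin N → ℤ) (a : ℂ) :
    diagOp h (AddMonoidAlgebra.single m a) = AddMonoidAlgebra.single m (h m * a) := by
  have : AddMonoidAlgebra.coeffLinearEquiv ℂ (AddMonoidAlgebra.single m a) = Finsupp.single m a :=
    rfl
  rw [diagOp, LinearMap.comp_apply, LinearEquiv.coe_coe, this, Finsupp.lsum_single,
    LinearMap.smul_apply]
  exact AddMonoidAlgebra.smul_single _ _ _

theorem coeff_diagOp (h : (Fin N → ℤ) → ℂ) (x : Laurent N) (m : Fin N → ℤ) :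
    (diagOp h x).coeff m = h m * x.coeff m := by
  classical
  induction x using AddMonoidAlgebra.induction_linear with
  | zero => simp
  | add x y hx hy => simp [hx, hy, mul_add]
  | single n a =>
    rw [diagOp_single, AddMonoidAlgebra.coeff_single, AddMonoidAlgebra.coeff_single,
      Finsupp.single_apply, Finsupp.single_apply]
    split_ifs with hn
    · rw [hn]
    · simp

/-- The Euler derivation `u_i ∂/∂u_i`. -/
noncomputable def euler (i : Fin N) : Derivation ℂ (Laurent N) (Laurent N) :=
  Derivation.mk' (diagOp fun m => (m i : ℂ)) <| by
    intro x y
    induction x using AddMonoidAlgebra.induction_linear with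
    | zero => simp
    | add a b ha hb => simp only [add_mul, map_add, ha, hb, smul_eq_mul]; ring
    | single m a =>
      induction y using AddMonoidAlgebra.induction_linear with
      | zero => simp
      | add c d hc hd => simp only [mul_add, map_add, hc, hd, smul_eq_mul]; ring
      | single n b =>
        simp only [AddMonoidAlgebra.single_mul_single, diagOp_single, smul_eq_mul, Pi.add_apply,
          add_comm n m, ← AddMonoidAlgebra.single_add]
        push_cast
        ring_nf

theorem euler_apply (i : Fin N) (x : Laurent N) : euler i x = diagOp (fun m => (m i : ℂ)) x :=
  rfl

/-- The monomial `u_i ^ k`. -/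
noncomputable def mono (i : Fin N) (k : ℤ) : Laurent N :=
  AddMonoidAlgebra.single (Pi.single i k) 1

theorem mono_add (i : Fin N) (k l : ℤ) : mono i (k + l) = mono i k * mono i l := by
  simp [mono, AddMonoidAlgebra.single_mul_single, Pi.single_add]

theorem mono_zero (i : Fin N) : mono i 0 = 1 := by
  simp [mono, AddMonoidAlgebra.one_def]

theorem mono_natCast (i : Fin N) (n : ℕ) : mono i n = mono i 1 ^ n := by
  induction n with
  | zero => simpa using mono_zero i
  | succ n ih => rw [Nat.cast_succ, mono_add, ih, pow_succ]

theorem prod_mono (m : Fin N → ℤ) : ∏ i, mono i (m i) = AddMonoidAlgebra.single m 1 := by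
  have h := map_prod (AddMonoidAlgebra.of ℂ (Fin N → ℤ))
    (fun i => Multiplicative.ofAdd (Pi.single i (m i) : Fin N → ℤ)) Finset.univ
  rw [← ofAdd_sum, Finset.univ_sum_single] at h
  exact h.symm

theorem euler_mono_self (i : Fin N) (k : ℤ) :
    euler i (mono i k) = (k : Laurent N) * mono i k := by
  rw [euler_apply, mono, diagOp_single, Pi.single_eq_same, ← AddMonoidAlgebra.smul_single',
    Int.cast_smul_eq_zsmul, zsmul_eq_mul]

theorem euler_mono_of_ne {i j : Fin N} (h : i ≠ j) (k : ℤ) : euler i (mono j k) = 0 := by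
  rw [euler_apply, mono, diagOp_single, Pi.single_eq_of_ne h]
  simp

/-- The derivation `∑ i, u_i ^ (k + 1) ∂/∂u_i`, a generator of the Witt algebra. -/
noncomputable def witt (k : ℤ) : Derivation ℂ (Laurent N) (Laurent N) :=
  ∑ i, mono i k • euler i

theorem witt_apply (k : ℤ) (x : Laurent N) : witt k x = ∑ i, mono i k * euler i x := by
  have h := map_sum (Derivation.coeFnAddMonoidHom (R := ℂ) (A := Laurent N) (M := Laurent N))
    (fun i => mono i k • euler i) Finset.univ
  exact (congrFun h x).trans (Finset.sum_apply _ _ _)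

theorem witt_mono (k l : ℤ) (i : Fin N) : witt k (mono i l) = (l : Laurent N) * mono i (k + l) := by
  rw [witt_apply, Finset.sum_eq_single i
    (fun j _ h => by rw [euler_mono_of_ne h, mul_zero]) (by simp), euler_mono_self, mono_add]
  ring

/-- The power sum `u_0 ^ k + … + u_{N-1} ^ k`. -/
noncomputable def powSum (k : ℤ) : Laurent N := ∑ i, mono i k

theorem witt_powSum (k l : ℤ) :
    witt k (powSum l : Laurent N) = (l : Laurent N) * powSum (k + l) := by
  simp only [powSum, map_sum, witt_mono, Finset.mul_sum]

theorem euler_powSum (i : Fin N) (k : ℤ) :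
    euler i (powSum k) = (k : Laurent N) * mono i k := by
  rw [powSum, map_sum, Finset.sum_eq_single i (fun j _ h => euler_mono_of_ne h.symm k) (by simp),
    euler_mono_self]

end Operators

/-! ### The Vandermonde determinant -/

section Vandermonde

variable {N : ℕ}

/-- The Vandermonde determinant `∏ i < j, (u_j - u_i)`. -/
noncomputable def vander : Laurent N :=
  (Matrix.vandermonde fun i => mono i 1).det

theorem vander_eq_sum : (vander : Laurent N) = ∑ σ : Equiv.Perm (Fin N),
    AddMonoidAlgebra.single (fun i => ((σ i : ℕ) : ℤ)) ((Equiv.Perm.sign σ : ℤ) : ℂ) := by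
  rw [vander, ← Matrix.det_transpose, Matrix.det_apply']
  refine Finset.sum_congr rfl fun σ _ => ?_
  simp only [Matrix.transpose_apply, Matrix.vandermonde_apply, ← mono_natCast]
  rw [prod_mono, ← mul_one (((Equiv.Perm.sign σ : ℤ) : ℂ)), ← AddMonoidAlgebra.smul_single',
    Int.cast_smul_eq_zsmul, zsmul_eq_mul]

theorem sub_mul_signedSum_mono (i j : Fin N) (k : ℤ) :
    (mono i 1 - mono j 1) * signedSum k (fun a => mono i a * mono j (k - a)) =
      mono i 1 * mono i k - mono i 1 * mono j k := by
  rw [← AddMonoidHom.coe_mulLeft, map_signedSum]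
  simp only [AddMonoidHom.coe_mulLeft]
  calc signedSum k (fun a => (mono i 1 - mono j 1) * (mono i a * mono j (k - a)))
      = signedSum k (fun a => mono i (a + 1) * mono j (k - (a + 1) + 1) -
          mono i a * mono j (k - a + 1)) := by
        congr 1; ext1 a
        rw [show k - (a + 1) + 1 = k - a by ring, mono_add, mono_add]; ring
    _ = mono i 1 * mono i k - mono i 1 * mono j k := by
        rw [signedSum_telescope k fun a => mono i a * mono j (k - a + 1),
          show k - (k + 1) + 1 = 0 by ring, show k - 1 + 1 = k by ring, mono_zero, mono_add]
        ring

theorem two_smul_witt_mono_sub_mono (k : ℤ) (i j : Fin N) :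
    (2 • witt k) (mono j 1 - mono i 1) = (mono j 1 - mono i 1) *
      ((signedSum k (fun a => mono j a * mono i (k - a)) + mono j k) +
        (signedSum k (fun a => mono i a * mono j (k - a)) + mono i k)) := by
  rw [Derivation.smul_apply, map_sub, witt_mono, witt_mono, mono_add, mono_add, nsmul_eq_mul]
  push_cast
  linear_combination sub_mul_signedSum_mono i j k - sub_mul_signedSum_mono j i k

theorem derivation_prod_eq_mul_sum {R A ι : Type*} [CommSemiring R] [CommRing A] [Algebra R A]
    (D : Derivation R A A) (s : Finset ι) {f c : ι → A} (h : ∀ i ∈ s, D (f i) = f i * c i) :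
    D (∏ i ∈ s, f i) = (∏ i ∈ s, f i) * ∑ i ∈ s, c i := by
  classical
  induction s using Finset.induction_on with
  | empty => simp
  | insert i s hi ih =>
    rw [Finset.prod_insert hi, Finset.sum_insert hi, Derivation.leibniz,
      ih fun j hj => h j (Finset.mem_insert_of_mem hj), h i (Finset.mem_insert_self i s),
      smul_eq_mul, smul_eq_mul]
    ring

theorem two_mul_witt_vander (k : ℤ) :
    2 * witt k vander = (vander : Laurent N) *
      (∑ i, ∑ j, signedSum k (fun a => mono i a * mono j (k - a)) +
        ((N : Laurent N) - 1 - (k : Laurent N)) * powSum k) := by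
  set B : Fin N → Fin N → Laurent N := fun i j =>
    signedSum k (fun a => mono i a * mono j (k - a)) + mono i k with hB
  have hdiag : ∀ i, B i i = ((k : Laurent N) + 1) * mono i k := fun i => by
    simp only [hB, ← mono_add, add_sub_cancel, signedSum_const, zsmul_eq_mul]
    ring
  have hvander : (2 • witt k) vander = (vander : Laurent N) *
      ∑ i, ∑ j ∈ Finset.Ioi i, (B j i + B i j) := by
    rw [vander, Matrix.det_vandermonde]
    exact derivation_prod_eq_mul_sum _ _ fun i _ => derivation_prod_eq_mul_sum _ _ fun j _ =>
      two_smul_witt_mono_sub_mono k i j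
  rw [Derivation.smul_apply, nsmul_eq_mul, Nat.cast_ofNat] at hvander
  rw [hvander, Finset.sum_sum_Ioi_add_eq_sum_sum_off_diag]
  congr 1
  calc ∑ i, ∑ j ∈ {i}ᶜ, B j i = ∑ i, (∑ j, B j i - B i i) :=
        Finset.sum_congr rfl fun i _ => by
          rw [← Finset.sum_compl_add_sum {i}, Finset.sum_singleton, add_sub_cancel_right]
    _ = ∑ i, ∑ j, B i j - ∑ i, B i i := by
        rw [Finset.sum_sub_distrib, Finset.sum_comm]
    _ = _ := by
        simp only [hdiag, ← Finset.mul_sum]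
        simp only [hB, Finset.sum_add_distrib, Finset.sum_const, Finset.card_univ,
          Fintype.card_fin, nsmul_eq_mul, ← Finset.mul_sum, powSum]
        ring

end Vandermonde

/-! ### The flat Laplacian -/

section FlatLaplacian

variable {N : ℕ}

/-- The eigenvalue of the flat Laplacian on `u ^ m`, normalized so that it vanishes at the
exponents `m = (0, 1, …, N - 1)` of the Vandermonde determinant. -/
def casimir (m : Fin N → ℤ) : ℤ :=
  ∑ i, (m i ^ 2 - (N - 1) * m i) - ∑ i : Fin N, ((i : ℤ) ^ 2 - (N - 1) * (i : ℤ))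

theorem casimir_perm (σ : Equiv.Perm (Fin N)) : casimir (fun i => ((σ i : ℕ) : ℤ)) = 0 := by
  rw [casimir, Equiv.sum_comp σ fun i : Fin N => ((i : ℤ) ^ 2 - (N - 1) * (i : ℤ)), sub_self]

/-- The Laplacian of the torus, shifted so that it annihilates the Vandermonde determinant. -/
noncomputable def flatLap : Laurent N →ₗ[ℂ] Laurent N := diagOp fun m => (casimir m : ℂ)

theorem flatLap_vander : flatLap (vander : Laurent N) = 0 := by
  rw [vander_eq_sum, map_sum]
  refine Finset.sum_eq_zero fun σ _ => ?_
  rw [flatLap, diagOp_single, casimir_perm]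
  simp

theorem exists_flatLap_eq : ∃ c : ℂ, ∀ x : Laurent N,
    flatLap x = ∑ i, (euler i (euler i x) - ((N : ℂ) - 1) • euler i x) - c • x := by
  refine ⟨((∑ i : Fin N, ((i : ℤ) ^ 2 - (N - 1) * (i : ℤ)) : ℤ) : ℂ), fun x => ?_⟩
  ext m
  simp only [flatLap, euler_apply, AddMonoidAlgebra.coeff_sub, AddMonoidAlgebra.coeff_sum,
    AddMonoidAlgebra.coeff_smul, coeff_diagOp, Finsupp.coe_sub, Pi.sub_apply,
    Finsupp.finsetSum_apply, Finsupp.smul_apply, smul_eq_mul, casimir]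
  push_cast
  rw [sub_mul, Finset.sum_mul]
  congr 1
  refine Finset.sum_congr rfl fun i _ => ?_
  ring

theorem flatLap_powSum_mul (k : ℤ) (x : Laurent N) :
    flatLap (powSum k * x) = powSum k * flatLap x +
      ((k : Laurent N) ^ 2 - ((N : Laurent N) - 1) * (k : Laurent N)) * powSum k * x +
        2 * (k : Laurent N) * witt k x := by
  obtain ⟨c, hc⟩ := exists_flatLap_eq (N := N)
  have hterm : ∀ i, euler i (euler i (powSum k * x)) - ((N : ℂ) - 1) • euler i (powSum k * x) =
      powSum k * (euler i (euler i x) - ((N : ℂ) - 1) • euler i x) +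
      ((k : Laurent N) ^ 2 - ((N : Laurent N) - 1) * (k : Laurent N)) * mono i k * x +
      2 * (k : Laurent N) * (mono i k * euler i x) := by
    intro i
    simp only [Derivation.leibniz, map_add, smul_eq_mul, euler_powSum, euler_mono_self,
      Derivation.map_intCast, Algebra.smul_def, map_sub, map_natCast, map_one]
    ring
  rw [hc, hc, Finset.sum_congr rfl fun i _ => hterm i, Finset.sum_add_distrib,
    Finset.sum_add_distrib, ← Finset.mul_sum, ← Finset.mul_sum, ← witt_apply, mul_sub,
    mul_smul_comm, ← Finset.sum_mul, ← Finset.mul_sum, ← powSum]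
  ring

end FlatLaplacian

end Laurent

open Laurent

/-! ### The radial part of the Laplacian -/

section Radial

variable {N : ℕ}

/-- The Laurent polynomial obtained by substituting the power sums for the variables. -/
noncomputable def toLaurent : TracePoly →ₐ[ℂ] Laurent N := MvPolynomial.aeval powSum

theorem toLaurent_X (k : ℤ) : toLaurent (MvPolynomial.X k) = (powSum k : Laurent N) :=
  MvPolynomial.aeval_X _ _

theorem witt_toLaurent (k : ℤ) (f : TracePoly) :
    witt k (toLaurent f : Laurent N) = toLaurent (loopContract k (grad f)) := by
  induction f using MvPolynomial.induction_on with
  | C a => rw [toLaurent, MvPolynomial.aeval_C, Derivation.map_algebraMap]; simp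
  | add p q hp hq => simp only [map_add, hp, hq]
  | mul_X p l hp =>
    rw [mul_comm p, grad_X_mul, map_add, map_smul, loopContract_single, smul_eq_mul,
      map_mul toLaurent (MvPolynomial.X l), Derivation.leibniz, hp]
    simp only [map_add, map_mul, toLaurent_X, map_intCast, witt_powSum, smul_eq_mul]
    ring

theorem toLaurent_loopSum (k : ℤ) : (toLaurent (loopSum k) : Laurent N) =
    ∑ i, ∑ j, signedSum k (fun a => mono i a * mono j (k - a)) := by
  simp only [loopSum, map_signedSum, map_mul, toLaurent_X, powSum, Finset.sum_mul_sum,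
    ← signedSum_sum]

theorem vander_mul_toLaurent_laplacian (f : TracePoly) :
    (vander : Laurent N) * toLaurent (laplacian f) = flatLap (vander * toLaurent f) := by
  induction f using MvPolynomial.induction_on with
  | C a =>
    have : (vander : Laurent N) * toLaurent (MvPolynomial.C a) = a • vander := by
      rw [toLaurent, MvPolynomial.aeval_C, mul_comm, Algebra.smul_def]
    rw [laplacian_C, map_zero, mul_zero, this, map_smul, flatLap_vander, smul_zero]
  | add p q hp hq => simp only [map_add, mul_add, hp, hq]
  | mul_X p k hp =>
    have hvander := two_mul_witt_vander (N := N) k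
    rw [← toLaurent_loopSum] at hvander
    rw [mul_comm p, laplacian_X_mul, map_mul toLaurent (MvPolynomial.X k), toLaurent_X,
      mul_left_comm, flatLap_powSum_mul, Derivation.leibniz, smul_eq_mul, smul_eq_mul,
      witt_toLaurent, ← hp]
    simp only [map_add, map_mul, toLaurent_X, map_intCast, map_ofNat]
    linear_combination -(k : Laurent N) * toLaurent p * hvander

end Radial

/-! ### Eigenvalues and power traces -/

section CharpolyRoots

variable {K n : Type*} [Field K] [IsAlgClosed K] [Fintype n] [DecidableEq n]

theorem card_roots_charpoly (A : Matrix n n K) : A.charpoly.roots.card = Fintype.card n := by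
  rw [← (IsAlgClosed.splits A.charpoly).natDegree_eq_card_roots, Matrix.charpoly_natDegree_eq_dim]

theorem det_sub_algebraMap_eq_prod_roots (A : Matrix n n K) (r : K) :
    (A - algebraMap K _ r).det = (A.charpoly.roots.map fun u => u - r).prod := by
  have heval : A.charpoly.eval r = (A.charpoly.roots.map fun u => r - u).prod := by
    conv_lhs => rw [(IsAlgClosed.splits A.charpoly).eq_prod_roots_of_monic A.charpoly_monic]
    rw [Polynomial.eval_multiset_prod, Multiset.map_map]
    simp
  have hneg : A - algebraMap K _ r = -(Matrix.scalar n r - A) := by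
    rw [neg_sub]; rfl
  rw [hneg, Matrix.det_neg, ← Matrix.eval_charpoly, heval, ← card_roots_charpoly A,
    ← Multiset.card_map (fun u => r - u), ← Multiset.prod_map_neg, Multiset.map_map]
  simp

theorem det_aeval_prod_X_sub_C (A : Matrix n n K) (s : Multiset K) :
    (Polynomial.aeval A (s.map fun a => Polynomial.X - Polynomial.C a).prod).det =
      (A.charpoly.roots.map fun r =>
        Polynomial.eval r (s.map fun a => Polynomial.X - Polynomial.C a).prod).prod := by
  induction s using Multiset.induction_on with
  | empty => simp
  | cons a s ih =>
    simp only [Multiset.map_cons, Multiset.prod_cons, map_mul, Matrix.det_mul, ih,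
      Polynomial.eval_mul, Multiset.prod_map_mul, map_sub, Polynomial.aeval_X, Polynomial.aeval_C,
      det_sub_algebraMap_eq_prod_roots, Polynomial.eval_sub, Polynomial.eval_X, Polynomial.eval_C]

theorem det_aeval_eq_prod_roots (A : Matrix n n K) (p : Polynomial K) :
    (Polynomial.aeval A p).det = (A.charpoly.roots.map fun r => p.eval r).prod := by
  conv_lhs => rw [(IsAlgClosed.splits p).eq_prod_roots]
  conv_rhs => rw [(IsAlgClosed.splits p).eq_prod_roots]
  simp only [map_mul, Polynomial.aeval_C, Matrix.det_mul, det_aeval_prod_X_sub_C,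
    Polynomial.eval_mul, Polynomial.eval_C, Multiset.prod_map_mul, Multiset.map_const',
    Multiset.prod_replicate, card_roots_charpoly]
  rw [Algebra.algebraMap_eq_smul_one, Matrix.det_smul, Matrix.det_one, mul_one]

theorem trace_pow_eq_sum_roots (A : Matrix n n K) (k : ℕ) :
    (A ^ k).trace = (A.charpoly.roots.map fun r => r ^ k).sum := by
  have hcharpoly : (A ^ k).charpoly = ((A.charpoly.roots.map fun r => r ^ k).map
      fun a => Polynomial.X - Polynomial.C a).prod := by
    refine Polynomial.funext fun x => ?_
    have := det_aeval_eq_prod_roots A (Polynomial.C x - Polynomial.X ^ k)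
    rw [map_sub, map_pow, Polynomial.aeval_X, Polynomial.aeval_C] at this
    rw [Matrix.eval_charpoly, Polynomial.eval_multiset_prod, Multiset.map_map, Multiset.map_map,
      show (Matrix.scalar n) x = algebraMap K (Matrix n n K) x from rfl, this]
    simp
  rw [Matrix.trace_eq_sum_roots_charpoly, hcharpoly, Polynomial.roots_multiset_prod_X_sub_C]

end CharpolyRoots

section UnitaryEigenvalues

variable {N : ℕ}

section

open scoped Matrix.Norms.L2Operator

theorem norm_eq_one_of_mem_roots_charpoly (U : Matrix.unitaryGroup (Fin N) ℂ) {r : ℂ}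
    (hr : r ∈ U.1.charpoly.roots) : ‖r‖ = 1 := by
  refine spectrum.norm_eq_one_of_unitary (E := Matrix (Fin N) (Fin N) ℂ) (𝕜 := ℂ) U.2 ?_
  rw [Matrix.mem_spectrum_iff_isRoot_charpoly]
  exact (Polynomial.mem_roots'.mp hr).2

end

theorem exists_eigenvalues (U : Matrix.unitaryGroup (Fin N) ℂ) :
    ∃ u : Fin N → Circle, U.1.charpoly.roots = Finset.univ.val.map fun i => (u i : ℂ) := by
  have hlen : U.1.charpoly.roots.toList.length = N := by
    rw [Multiset.length_toList, card_roots_charpoly, Fintype.card_fin]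
  refine ⟨fun i => ⟨U.1.charpoly.roots.toList.get (i.cast hlen.symm), ?_⟩, ?_⟩
  · refine mem_sphere_zero_iff_norm.mpr ?_
    exact norm_eq_one_of_mem_roots_charpoly U (Multiset.mem_toList.mp (List.get_mem _ _))
  · rw [Fin.univ_val_map]
    conv_lhs => rw [← Multiset.coe_toList U.1.charpoly.roots]
    congr 1
    refine List.ext_get (by simp [hlen]) fun n _ _ => ?_
    simp

/-- The power sum `∑ i, u_i ^ k` of a point of the torus, as a function of `k`. -/
noncomputable def circlePowSum (u : Fin N → Circle) (k : ℤ) : ℂ := ∑ i, ((u i ^ k : Circle) : ℂ)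

theorem powTrace_eq_circlePowSum {U : Matrix.unitaryGroup (Fin N) ℂ} {u : Fin N → Circle}
    (hu : U.1.charpoly.roots = Finset.univ.val.map fun i => (u i : ℂ)) :
    powTrace U = circlePowSum u := by
  have hnat : ∀ n : ℕ, powTrace U n = circlePowSum u n := by
    intro n
    rw [powTrace, zpow_natCast, SubmonoidClass.coe_pow, trace_pow_eq_sum_roots, hu,
      Multiset.map_map, circlePowSum]
    simp [Finset.sum]
  ext k
  rcases Int.eq_nat_or_neg k with ⟨n, rfl | rfl⟩
  · exact hnat n
  · have hneg : powTrace U (-n) = star (powTrace U n) := by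
      rw [powTrace, powTrace, zpow_neg, ← Matrix.trace_conjTranspose]
      rfl
    rw [hneg, hnat, circlePowSum, circlePowSum]
    simp [← Circle.coe_inv_eq_conj]

end UnitaryEigenvalues

namespace Laurent

/-! ### Antisymmetric Laurent polynomials -/

section Antisymmetry

variable {N : ℕ}

/-- The automorphism of the Laurent polynomials that permutes the variables. -/
noncomputable def permAct (σ : Equiv.Perm (Fin N)) : Laurent N ≃ₐ[ℂ] Laurent N :=
  AddMonoidAlgebra.domCongr ℂ ℂ
    { toFun := fun m : Fin N → ℤ => m ∘ σ
      invFun := fun m => m ∘ σ.symm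
      left_inv := fun m => by ext; simp
      right_inv := fun m => by ext; simp
      map_add' := fun _ _ => rfl }

theorem permAct_single (σ : Equiv.Perm (Fin N)) (m : Fin N → ℤ) (a : ℂ) :
    permAct σ (AddMonoidAlgebra.single m a) = AddMonoidAlgebra.single (m ∘ σ) a := by
  simp [permAct]

theorem coeff_permAct (σ : Equiv.Perm (Fin N)) (x : Laurent N) (m : Fin N → ℤ) :
    (permAct σ x).coeff (m ∘ σ) = x.coeff m := by
  classical
  induction x using AddMonoidAlgebra.induction_linear with
  | zero => simp
  | add x y hx hy => simp [hx, hy]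
  | single n a =>
    rw [permAct_single, AddMonoidAlgebra.coeff_single, AddMonoidAlgebra.coeff_single,
      Finsupp.single_apply, Finsupp.single_apply]
    simp only [σ.surjective.injective_comp_right.eq_iff]

theorem permAct_powSum (σ : Equiv.Perm (Fin N)) (k : ℤ) : permAct σ (powSum k) = powSum k := by
  rw [powSum, map_sum, ← Equiv.sum_comp σ]
  refine Finset.sum_congr rfl fun i _ => ?_
  rw [mono, permAct_single, mono]
  congr 1
  ext j
  simp [Pi.single_apply]

theorem permAct_vander (σ : Equiv.Perm (Fin N)) :
    permAct σ vander = ((Equiv.Perm.sign σ : ℤ) : ℂ) • vander := by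
  rw [vander_eq_sum, map_sum, Finset.smul_sum]
  refine Fintype.sum_equiv (Equiv.mulRight σ) _ _ fun τ => ?_
  rw [permAct_single, AddMonoidAlgebra.smul_single', Equiv.coe_mulRight, Equiv.Perm.sign_mul,
    ← Int.cast_mul, ← Units.val_mul, mul_comm, mul_assoc, Int.units_mul_self, mul_one]
  rfl

/-- A Laurent polynomial is antisymmetric if permuting variables multiplies it by the sign. -/
def IsAntisymm (x : Laurent N) : Prop :=
  ∀ (σ : Equiv.Perm (Fin N)) (m : Fin N → ℤ),
    x.coeff (m ∘ σ) = ((Equiv.Perm.sign σ : ℤ) : ℂ) * x.coeff m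

theorem isAntisymm_vander_mul {y : Laurent N} (hy : ∀ σ, permAct σ y = y) :
    IsAntisymm (vander * y) := by
  intro σ m
  have hperm : permAct σ (vander * y) = ((Equiv.Perm.sign σ : ℤ) : ℂ) • (vander * y) := by
    rw [map_mul, hy, permAct_vander, smul_mul_assoc]
  have hcoeff := coeff_permAct σ (vander * y) m
  rw [hperm, AddMonoidAlgebra.coeff_smul_apply, smul_eq_mul] at hcoeff
  rw [← hcoeff, ← mul_assoc, ← Int.cast_mul, ← Units.val_mul, Int.units_mul_self]
  simp

theorem IsAntisymm.coeff_eq_zero {x : Laurent N} (hx : IsAntisymm x) {m : Fin N → ℤ}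
    (hm : ¬ Function.Injective m) : x.coeff m = 0 := by
  obtain ⟨i, j, hij, hne⟩ := Function.not_injective_iff.mp hm
  have h := hx (Equiv.swap i j) m
  have hswap : m ∘ Equiv.swap i j = m := by
    ext l
    simp only [Function.comp_apply, Equiv.swap_apply_def]
    split_ifs <;> simp [*]
  rw [hswap, Equiv.Perm.sign_swap hne] at h
  simp only [Units.val_neg, Units.val_one, Int.cast_neg, Int.cast_one, neg_mul, one_mul] at h
  exact self_eq_neg.mp h

theorem coeff_vander (σ : Equiv.Perm (Fin N)) :
    (vander : Laurent N).coeff (fun i => ((σ i : ℕ) : ℤ)) = ((Equiv.Perm.sign σ : ℤ) : ℂ) := by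
  classical
  rw [vander_eq_sum, AddMonoidAlgebra.coeff_sum, Finsupp.finsetSum_apply, Finset.sum_eq_single σ]
  · simp
  · intro τ _ hτ
    rw [AddMonoidAlgebra.coeff_single, Finsupp.single_apply, if_neg]
    intro h
    apply hτ
    ext i
    simpa using congrFun h i
  · simp

theorem vander_ne_zero : (vander : Laurent N) ≠ 0 := by
  intro h
  have := coeff_vander (1 : Equiv.Perm (Fin N))
  simp [h] at this

/-- `n ^ 2 - (N - 1) n` is positive at the integers outside `[0, N)` and nonpositive on `[0, N)`, so
exchanging an exponent in `[0, N)` for one outside it increases the eigenvalue. -/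
theorem mem_Ico_of_casimir_eq_zero {m : Fin N → ℤ} (hm : Function.Injective m)
    (h : casimir m = 0) (i : Fin N) : 0 ≤ m i ∧ m i < N := by
  set q : ℤ → ℤ := fun n => n ^ 2 - (N - 1) * n with hq
  set S := Finset.univ.image m
  set R := Finset.univ.image fun j : Fin N => ((j : ℕ) : ℤ)
  have hmem : ∀ n, n ∈ R ↔ 0 ≤ n ∧ n < N := by
    intro n
    refine ⟨fun hn => ?_, fun hn => ?_⟩
    · obtain ⟨j, -, rfl⟩ := Finset.mem_image.mp hn
      omega
    · exact Finset.mem_image.mpr ⟨⟨n.toNat, by omega⟩, Finset.mem_univ _, by simp [hn.1]⟩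
  have hcasimir : ∑ n ∈ S \ R, q n - ∑ n ∈ R \ S, q n = 0 := by
    have hinj : Function.Injective fun j : Fin N => ((j : ℕ) : ℤ) := fun j l hjl =>
      Fin.ext (by simpa using hjl)
    rw [Finset.sum_sdiff_sub_sum_sdiff, Finset.sum_image hm.injOn, Finset.sum_image hinj.injOn]
    exact h
  have hnonpos : ∑ n ∈ R \ S, q n ≤ 0 := by
    refine Finset.sum_nonpos fun n hn => ?_
    have := (hmem n).mp (Finset.mem_sdiff.mp hn).1
    simp only [hq]
    nlinarith
  have hpos : ∀ n ∈ S \ R, 0 < q n := by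
    intro n hn
    have hnR := (hmem n).not.mp (Finset.mem_sdiff.mp hn).2
    have hN : (0 : ℤ) < N := by exact_mod_cast i.pos
    simp only [hq]
    rcases lt_or_ge n 0 with h0 | h0
    · nlinarith
    · have : (N : ℤ) ≤ n := by omega
      nlinarith
  by_contra hi
  have hS : m i ∈ S \ R := Finset.mem_sdiff.mpr
    ⟨Finset.mem_image_of_mem m (Finset.mem_univ i), (hmem _).not.mpr hi⟩
  linarith [Finset.sum_pos hpos ⟨_, hS⟩]

theorem exists_perm_of_casimir_eq_zero {m : Fin N → ℤ} (hm : Function.Injective m)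
    (h : casimir m = 0) : ∃ σ : Equiv.Perm (Fin N), m = fun i => ((σ i : ℕ) : ℤ) := by
  have hr := mem_Ico_of_casimir_eq_zero hm h
  have hinj : Function.Injective fun i => (⟨(m i).toNat, by have := hr i; omega⟩ : Fin N) := by
    intro i j hij
    have := hr i
    have := hr j
    apply hm
    have htoNat : (m i).toNat = (m j).toNat := congrArg Fin.val hij
    omega
  refine ⟨Equiv.ofBijective _ (Finite.injective_iff_bijective.mp hinj), ?_⟩
  ext i
  simp [(hr i).1]

theorem IsAntisymm.eq_smul_vander {x : Laurent N} (hx : IsAntisymm x)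
    (h : ∀ m, x.coeff m ≠ 0 → casimir m = 0) :
    x = x.coeff (fun i => ((i : ℕ) : ℤ)) • vander := by
  have hv : IsAntisymm (vander : Laurent N) := by
    simpa using isAntisymm_vander_mul (y := 1) fun σ => map_one _
  have hvCasimir : ∀ m, (vander : Laurent N).coeff m ≠ 0 → casimir m = 0 := by
    intro m hne
    have := coeff_diagOp (fun m => (casimir m : ℂ)) vander m
    rw [← flatLap, flatLap_vander] at this
    simpa [hne] using this.symm
  ext m
  rw [AddMonoidAlgebra.coeff_smul_apply, smul_eq_mul]
  by_cases hm : ∃ σ : Equiv.Perm (Fin N), m = fun i => ((σ i : ℕ) : ℤ)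
  · obtain ⟨σ, rfl⟩ := hm
    rw [coeff_vander, mul_comm, ← hx σ fun i => ((i : ℕ) : ℤ)]
    rfl
  · have key : ∀ y : Laurent N, IsAntisymm y → (∀ m, y.coeff m ≠ 0 → casimir m = 0) →
        y.coeff m = 0 := by
      intro y hy hc
      by_contra hne
      exact hm (exists_perm_of_casimir_eq_zero (not_imp_comm.mp hy.coeff_eq_zero hne) (hc m hne))
    rw [key x hx h, key vander hv hvCasimir, mul_zero]

end Antisymmetry

section Evaluation

variable {N : ℕ}

/-- Evaluation of a Laurent polynomial at a point of the torus. -/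
noncomputable def evalAt (u : Fin N → Circle) : Laurent N →ₐ[ℂ] ℂ :=
  AddMonoidAlgebra.lift ℂ ℂ (Fin N → ℤ)
    { toFun := fun m => ((∏ i, u i ^ (m.toAdd i) : Circle) : ℂ)
      map_one' := by simp
      map_mul' := fun m n => by simp [zpow_add, Finset.prod_mul_distrib] }

theorem evalAt_single (u : Fin N → Circle) (m : Fin N → ℤ) (a : ℂ) :
    evalAt u (AddMonoidAlgebra.single m a) = a * ((∏ i, u i ^ m i : Circle) : ℂ) := by
  simp [evalAt]

theorem evalAt_mono (u : Fin N → Circle) (i : Fin N) (k : ℤ) :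
    evalAt u (mono i k) = ((u i ^ k : Circle) : ℂ) := by
  rw [mono, evalAt_single, one_mul, Finset.prod_eq_single i]
  · simp
  · intro j _ hj; simp [hj]
  · simp

theorem evalAt_powSum (u : Fin N → Circle) (k : ℤ) : evalAt u (powSum k) = circlePowSum u k := by
  simp only [powSum, map_sum, evalAt_mono, circlePowSum]

end Evaluation

end Laurent

/-! ### The moments of the circular unitary ensemble -/

section Moments

variable {N : ℕ}

theorem permAct_toLaurent (σ : Equiv.Perm (Fin N)) (f : TracePoly) :
    permAct σ (toLaurent f) = toLaurent f := by
  have h : (permAct σ).toAlgHom.comp toLaurent = toLaurent := by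
    refine MvPolynomial.algHom_ext fun k => ?_
    simpa [toLaurent_X] using permAct_powSum σ k
  exact DFunLike.congr_fun h f

theorem evalAt_toLaurent (u : Fin N → Circle) (f : TracePoly) :
    evalAt u (toLaurent f) = MvPolynomial.eval (circlePowSum u) f := by
  have h : (evalAt u).comp toLaurent = MvPolynomial.aeval (circlePowSum u) := by
    refine MvPolynomial.algHom_ext fun k => ?_
    rw [AlgHom.comp_apply, toLaurent_X, evalAt_powSum, MvPolynomial.aeval_X]
  exact DFunLike.congr_fun h f

theorem map_aeval_apply_eq_smul {R M M' : Type*} [CommSemiring R] [AddCommMonoid M]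
    [AddCommMonoid M'] [Module R M] [Module R M'] (A : Module.End R M) (g : M →ₗ[R] M') (c : R)
    (h : ∀ x, g (A x) = c • g x) (P : Polynomial R) (x : M) :
    g (Polynomial.aeval A P x) = P.eval c • g x := by
  induction P using Polynomial.induction_on with
  | C a => simp
  | add p q hp hq => simp [hp, hq, add_smul]
  | monomial n a ih =>
    rw [pow_succ', ← mul_assoc, mul_comm (Polynomial.C a), mul_assoc]
    generalize Polynomial.C a * Polynomial.X ^ n = q at ih ⊢
    rw [map_mul, Polynomial.aeval_X, Module.End.mul_apply, h, ih, Polynomial.eval_mul,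
      Polynomial.eval_X, mul_smul]

/-- The expectation over `CUE_N` of a polynomial in the power traces. -/
noncomputable def moment (N : ℕ) : TracePoly →ₗ[ℂ] ℂ where
  toFun f := ∫ U, MvPolynomial.eval (powTrace U) f ∂(cue N)
  map_add' f g := by
    simp only [map_add]
    exact integral_add (integrable_cue_of_continuous (continuous_eval_powTrace f))
      (integrable_cue_of_continuous (continuous_eval_powTrace g))
  map_smul' c f := by
    simp only [MvPolynomial.smul_eval, RingHom.id_apply, smul_eq_mul]
    exact integral_const_mul c _

/-- The coefficient of `u ^ m` in the product of the Vandermonde determinant and `f`. -/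
noncomputable def vanderCoeff (m : Fin N → ℤ) : TracePoly →ₗ[ℂ] ℂ where
  toFun f := (vander * toLaurent f).coeff m
  map_add' f g := by simp [mul_add]
  map_smul' c f := by simp

theorem vanderCoeff_laplacian (m : Fin N → ℤ) (f : TracePoly) :
    vanderCoeff m (laplacian f) = (casimir m : ℂ) • vanderCoeff m f := by
  change (vander * toLaurent (laplacian f)).coeff m = _
  rw [vander_mul_toLaurent_laplacian, flatLap, coeff_diagOp]
  rfl

theorem moment_eq_vanderCoeff_of_forall {f : TracePoly}
    (hf : ∀ m : Fin N → ℤ, vanderCoeff m f ≠ 0 → casimir m = 0) :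
    moment N f = vanderCoeff (fun i : Fin N => ((i : ℕ) : ℤ)) f := by
  set a := vanderCoeff (fun i : Fin N => ((i : ℕ) : ℤ)) f
  have hsmul : vander * toLaurent f = a • (vander : Laurent N) :=
    (isAntisymm_vander_mul fun σ => permAct_toLaurent σ f).eq_smul_vander hf
  have hconst : toLaurent f = algebraMap ℂ (Laurent N) a := by
    refine mul_left_cancel₀ vander_ne_zero ?_
    rw [hsmul, Algebra.smul_def, mul_comm]
  have heval : ∀ U : Matrix.unitaryGroup (Fin N) ℂ, MvPolynomial.eval (powTrace U) f = a := by
    intro U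
    obtain ⟨u, hu⟩ := exists_eigenvalues U
    rw [powTrace_eq_circlePowSum hu, ← evalAt_toLaurent, hconst, AlgHom.commutes]
    rfl
  simp [moment, heval]

/-- A polynomial in the Laplacian that equals `1` at `0` preserves both sides; it can be chosen to
kill all the other eigenvalues occurring in `f`. -/
theorem integral_eval_powTrace (f : TracePoly) :
    ∫ U, MvPolynomial.eval (powTrace U) f ∂(cue N) =
      (vander * toLaurent f).coeff fun i : Fin N => ((i : ℕ) : ℤ) := by
  set S := (((vander : Laurent N) * toLaurent f).coeff.support.image casimir).erase 0
  set P : Polynomial ℂ := ∏ c ∈ S, (1 - Polynomial.C (c : ℂ)⁻¹ * Polynomial.X) with hP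
  have hmoment : moment N (Polynomial.aeval laplacian P f) = moment N f := by
    rw [map_aeval_apply_eq_smul laplacian (moment N) 0
      (fun g => (integral_laplacian g).trans (zero_smul ℂ _).symm)]
    simp [hP, Polynomial.eval_prod]
  have hcoeff : ∀ m : Fin N → ℤ, vanderCoeff m (Polynomial.aeval laplacian P f) =
      P.eval (casimir m : ℂ) • vanderCoeff m f := fun m =>
    map_aeval_apply_eq_smul laplacian (vanderCoeff m) _ (vanderCoeff_laplacian m) P f
  have hground : ∀ m : Fin N → ℤ,
      vanderCoeff m (Polynomial.aeval laplacian P f) ≠ 0 → casimir m = 0 := by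
    intro m
    rw [hcoeff, smul_eq_mul]
    contrapose!
    intro hm
    by_cases hf : vanderCoeff m f = 0
    · rw [hf, mul_zero]
    · have hmS : casimir m ∈ S := Finset.mem_erase.mpr
        ⟨hm, Finset.mem_image_of_mem _ (Finsupp.mem_support_iff.mpr hf)⟩
      rw [hP, Polynomial.eval_prod, Finset.prod_eq_zero hmS, zero_mul]
      simp [hm]
  have hid : P.eval (casimir fun i : Fin N => ((i : ℕ) : ℤ) : ℂ) = 1 := by
    rw [show casimir (fun i : Fin N => ((i : ℕ) : ℤ)) = 0 from casimir_perm 1]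
    simp [hP, Polynomial.eval_prod]
  have := moment_eq_vanderCoeff_of_forall hground
  rw [hmoment, hcoeff, hid, one_smul] at this
  exact this

end Moments

/-! ### The Weyl density on the torus -/

section Weyl

variable {N : ℕ}

/-- The box of phases `[0, 2π)^N`. -/
def box (N : ℕ) : Set (Fin N → ℝ) := Set.univ.pi fun _ => Set.Ico 0 (2 * Real.pi)

/-- The point of the torus with given phases. -/
noncomputable def torusExp (θ : Fin N → ℝ) (i : Fin N) : Circle := Circle.exp (θ i)

/-- The squared modulus of the Vandermonde determinant of the points with given phases. -/
noncomputable def vanderSq (θ : Fin N → ℝ) : ℝ := Complex.normSq (evalAt (torusExp θ) vander)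

/-- Weyl's measure: the joint law of the eigenphases in uniformly random order. -/
noncomputable def weyl (N : ℕ) : Measure (Fin N → ℝ) :=
  (volume.restrict (box N)).withDensity fun θ =>
    ENNReal.ofReal (vanderSq θ / (N.factorial * (2 * Real.pi) ^ N))

theorem measurableSet_box : MeasurableSet (box N) :=
  MeasurableSet.univ_pi fun _ => measurableSet_Ico

theorem continuous_torusExp : Continuous (torusExp : (Fin N → ℝ) → Fin N → Circle) :=
  continuous_pi fun i => Circle.exp.continuous.comp (continuous_apply i)

theorem continuous_evalAt_torusExp (x : Laurent N) :
    Continuous fun θ => evalAt (torusExp θ) x := by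
  induction x using AddMonoidAlgebra.induction_linear with
  | zero => simpa using continuous_const
  | add x y hx hy =>
    simp only [map_add]
    exact hx.add hy
  | single m a =>
    simp only [evalAt_single]
    have h : Continuous fun θ : Fin N → ℝ => ∏ i, torusExp θ i ^ m i :=
      continuous_finsetProd _ fun i _ => (((continuous_apply i).comp continuous_torusExp).zpow _)
    exact continuous_const.mul (continuous_subtype_val.comp h)

theorem continuous_vanderSq : Continuous (vanderSq : (Fin N → ℝ) → ℝ) :=
  Complex.continuous_normSq.comp (continuous_evalAt_torusExp _)

theorem integrable_box_of_continuous {E : Type*} [NormedAddCommGroup E] {f : (Fin N → ℝ) → E}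
    (hf : Continuous f) : Integrable f (volume.restrict (box N)) := by
  have : IntegrableOn f (Set.univ.pi fun _ => Set.Icc 0 (2 * Real.pi)) volume :=
    hf.continuousOn.integrableOn_compact (isCompact_univ_pi fun _ => isCompact_Icc)
  exact this.mono_set (Set.pi_mono fun _ _ => Set.Ico_subset_Icc_self)

instance isFiniteMeasure_weyl : IsFiniteMeasure (weyl N) :=
  isFiniteMeasure_withDensity_ofReal
    (integrable_box_of_continuous (continuous_vanderSq.div_const _)).2

theorem integral_circleExp_zpow (k : ℤ) :
    ∫ t in Set.Ico 0 (2 * Real.pi), ((Circle.exp t ^ k : Circle) : ℂ) =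
      if k = 0 then ((2 * Real.pi : ℝ) : ℂ) else 0 := by
  rw [integral_Ico_eq_integral_Ioc, ← intervalIntegral.integral_of_le Real.two_pi_pos.le]
  split_ifs with hk
  · simp [hk]
  · have hexp : ∀ t : ℝ, ((Circle.exp t ^ k : Circle) : ℂ) =
        Complex.exp ((k * Complex.I) * t) := by
      intro t
      rw [Circle.coe_zpow, Circle.coe_exp, ← Complex.exp_int_mul]
      ring_nf
    have hperiod : Complex.exp ((k * Complex.I) * ((2 * Real.pi : ℝ) : ℂ)) = 1 :=
      Complex.exp_eq_one_iff.mpr ⟨k, by push_cast; ring⟩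
    simp only [hexp]
    rw [integral_exp_mul_complex (by simp [hk]), hperiod]
    simp

theorem integral_evalAt_torusExp (x : Laurent N) :
    ∫ θ in box N, evalAt (torusExp θ) x = (2 * Real.pi) ^ N * x.coeff 0 := by
  classical
  induction x using AddMonoidAlgebra.induction_linear with
  | zero => simp
  | add x y hx hy =>
    simp only [map_add]
    rw [integral_add (integrable_box_of_continuous (continuous_evalAt_torusExp x))
      (integrable_box_of_continuous (continuous_evalAt_torusExp y)), hx, hy,
      AddMonoidAlgebra.coeff_add, Finsupp.add_apply]
    ring
  | single m a =>
    have hprod : ∀ θ : Fin N → ℝ, ((∏ i, torusExp θ i ^ m i : Circle) : ℂ) =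
        ∏ i, ((Circle.exp (θ i) ^ m i : Circle) : ℂ) := fun θ => map_prod Circle.coeHom _ _
    simp only [evalAt_single, hprod]
    rw [integral_const_mul, box, volume_pi, Measure.restrict_pi_pi,
      integral_fintype_prod_eq_prod fun i t => ((Circle.exp t ^ m i : Circle) : ℂ)]
    simp only [integral_circleExp_zpow, AddMonoidAlgebra.coeff_single, Finsupp.single_apply]
    by_cases hm : m = 0
    · subst hm
      simp [mul_comm]
    · obtain ⟨i, hi⟩ := Function.ne_iff.mp hm
      rw [if_neg hm, Finset.prod_eq_zero (Finset.mem_univ i) (if_neg hi)]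
      simp

theorem conj_evalAt_vander (u : Fin N → Circle) :
    (starRingEnd ℂ) (evalAt u vander) = evalAt u (∑ σ : Equiv.Perm (Fin N),
      AddMonoidAlgebra.single (-fun i => ((σ i : ℕ) : ℤ)) ((Equiv.Perm.sign σ : ℤ) : ℂ)) := by
  rw [vander_eq_sum, map_sum, map_sum, map_sum]
  refine Finset.sum_congr rfl fun σ _ => ?_
  rw [evalAt_single, evalAt_single, map_mul, ← Circle.coe_inv_eq_conj, ← Finset.prod_inv_distrib]
  simp

theorem Laurent.IsAntisymm.integral_conj_vander_mul {x : Laurent N} (hx : IsAntisymm x) :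
    ∫ θ in box N, (starRingEnd ℂ) (evalAt (torusExp θ) vander) * evalAt (torusExp θ) x =
      N.factorial * (2 * Real.pi) ^ N * x.coeff fun i => ((i : ℕ) : ℤ) := by
  have hcoeff : ∀ σ : Equiv.Perm (Fin N), (AddMonoidAlgebra.single (-fun i => ((σ i : ℕ) : ℤ))
      ((Equiv.Perm.sign σ : ℤ) : ℂ) * x).coeff 0 = x.coeff fun i => ((i : ℕ) : ℤ) := by
    intro σ
    have hσ : x.coeff (fun i => ((σ i : ℕ) : ℤ)) =
        ((Equiv.Perm.sign σ : ℤ) : ℂ) * x.coeff fun i => ((i : ℕ) : ℤ) :=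
      hx σ fun i => ((i : ℕ) : ℤ)
    rw [AddMonoidAlgebra.coeff_single_mul_eq_mul_coeff _
      (fun m _ => by rw [neg_add_eq_zero, eq_comm]), hσ, ← mul_assoc, ← Int.cast_mul,
      ← Units.val_mul, Int.units_mul_self, Units.val_one, Int.cast_one, one_mul]
  simp only [conj_evalAt_vander, ← map_mul]
  rw [integral_evalAt_torusExp, Finset.sum_mul, AddMonoidAlgebra.coeff_sum,
    Finsupp.finsetSum_apply, Finset.sum_congr rfl fun σ _ => hcoeff σ, Finset.sum_const,
    Finset.card_univ, Fintype.card_perm, Fintype.card_fin, nsmul_eq_mul]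
  ring

theorem integral_eval_circlePowSum_weyl (f : TracePoly) :
    ∫ θ, MvPolynomial.eval (circlePowSum (torusExp θ)) f ∂(weyl N) =
      (vander * toLaurent f).coeff fun i : Fin N => ((i : ℕ) : ℤ) := by
  have hdensity : ∀ θ : Fin N → ℝ,
      (ENNReal.ofReal (vanderSq θ / (N.factorial * (2 * Real.pi) ^ N))).toReal •
        MvPolynomial.eval (circlePowSum (torusExp θ)) f =
      (1 / (N.factorial * (2 * Real.pi) ^ N) : ℂ) * ((starRingEnd ℂ) (evalAt (torusExp θ) vander) *
        evalAt (torusExp θ) (vander * toLaurent f)) := by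
    intro θ
    have hnonneg : 0 ≤ vanderSq θ / (N.factorial * (2 * Real.pi) ^ N) :=
      div_nonneg (Complex.normSq_nonneg _) (by positivity)
    rw [ENNReal.toReal_ofReal hnonneg, map_mul, ← mul_assoc ((starRingEnd ℂ) _),
      ← Complex.normSq_eq_conj_mul_self, Complex.real_smul, vanderSq, evalAt_toLaurent]
    push_cast
    ring
  rw [weyl, integral_withDensity_eq_integral_toReal_smul
    (continuous_vanderSq.div_const _).measurable.ennreal_ofReal (ae_of_all _ fun _ => by simp)]
  simp only [hdensity]
  rw [integral_const_mul,
    (isAntisymm_vander_mul fun σ => permAct_toLaurent σ f).integral_conj_vander_mul]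
  have hfactorial : (N.factorial : ℂ) ≠ 0 := by exact_mod_cast N.factorial_ne_zero
  field_simp

end Weyl

/-! ### Equality of the laws of the power sums -/

section PowSumLaw

open BoundedContinuousFunction

theorem eval_rename_map_conj {ι : Type*} {σ : ι → ι} {z : ι → ℂ}
    (hz : ∀ i, z (σ i) = (starRingEnd ℂ) (z i)) (f : MvPolynomial ι ℂ) :
    MvPolynomial.eval z (MvPolynomial.rename σ (MvPolynomial.map (starRingEnd ℂ) f)) =
      (starRingEnd ℂ) (MvPolynomial.eval z f) := by
  rw [MvPolynomial.eval_rename, MvPolynomial.eval_map,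
    show z ∘ σ = starRingEnd ℂ ∘ z from funext hz]
  exact (MvPolynomial.eval₂_comp_left (starRingEnd ℂ) (RingHom.id ℂ) z f).symm

theorem exists_mvPolynomial_of_mem_adjoin {ι K : Type*} [TopologicalSpace K] (c : ι → K →ᵇ ℂ)
    {σ : ι → ι} {g : K →ᵇ ℂ} (hg : g ∈ StarAlgebra.adjoin ℂ (Set.range c)) :
    ∃ f : MvPolynomial ι ℂ, ∀ x, (∀ i, c (σ i) x = (starRingEnd ℂ) (c i x)) →
      g x = MvPolynomial.eval (fun i => c i x) f := by
  induction hg using StarAlgebra.adjoin_induction with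
  | mem x hx =>
    obtain ⟨i, rfl⟩ := hx
    exact ⟨MvPolynomial.X i, fun x _ => by simp⟩
  | algebraMap r => exact ⟨MvPolynomial.C r, fun x _ => by simp [Algebra.algebraMap_eq_smul_one]⟩
  | add x y _ _ hx hy =>
    obtain ⟨p, hp⟩ := hx
    obtain ⟨q, hq⟩ := hy
    exact ⟨p + q, fun x hx => by simp [hp x hx, hq x hx]⟩
  | mul x y _ _ hx hy =>
    obtain ⟨p, hp⟩ := hx
    obtain ⟨q, hq⟩ := hy
    exact ⟨p * q, fun x hx => by simp [hp x hx, hq x hx]⟩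
  | star x _ hx =>
    obtain ⟨p, hp⟩ := hx
    exact ⟨MvPolynomial.rename σ (MvPolynomial.map (starRingEnd ℂ) p), fun x hx => by
      simp [eval_rename_map_conj (z := fun i => c i x) hx, hp x hx]⟩

section MomentMethod

variable {ι Ω Ω' : Type*} [MeasurableSpace Ω] [MeasurableSpace Ω'] {μ : Measure Ω} {ν : Measure Ω'}
  [IsFiniteMeasure μ] [IsFiniteMeasure ν]

/-- The symmetry under `σ` turns conjugates of polynomials in the coordinates into polynomials, as
the Stone–Weierstrass theorem requires. -/
theorem map_eq_map_of_separating_of_forall_integral_eval_eq {K : Type*} [TopologicalSpace K]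
    [PolishSpace K] [MeasurableSpace K] [BorelSpace K] {c : ι → K →ᵇ ℂ}
    (hc : ∀ x y, (∀ i, c i x = c i y) → x = y) {X : Ω → K} {Y : Ω' → K} (hX : Measurable X)
    (hY : Measurable Y) (σ : ι → ι)
    (hXσ : ∀ ω i, c (σ i) (X ω) = (starRingEnd ℂ) (c i (X ω)))
    (hYσ : ∀ ω i, c (σ i) (Y ω) = (starRingEnd ℂ) (c i (Y ω)))
    (h : ∀ f, ∫ ω, MvPolynomial.eval (fun i => c i (X ω)) f ∂μ =
      ∫ ω, MvPolynomial.eval (fun i => c i (Y ω)) f ∂ν) :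
    μ.map X = ν.map Y := by
  have := Measure.isFiniteMeasure_map μ X
  have := Measure.isFiniteMeasure_map ν Y
  refine ext_of_forall_mem_subalgebra_integral_eq_of_polish (𝕜 := ℂ)
    (A := StarAlgebra.adjoin ℂ (Set.range c)) ?_ fun g hg => ?_
  · intro x y hxy
    obtain ⟨i, hi⟩ := not_forall.mp (mt (hc x y) hxy)
    exact ⟨c i, ⟨(c i).toContinuousMap,
      ⟨c i, StarAlgebra.subset_adjoin ℂ _ (Set.mem_range_self i), rfl⟩, rfl⟩, hi⟩
  · obtain ⟨f, hf⟩ := exists_mvPolynomial_of_mem_adjoin c (σ := σ) hg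
    rw [integral_map hX.aemeasurable g.continuous.aestronglyMeasurable,
      integral_map hY.aemeasurable g.continuous.aestronglyMeasurable]
    calc ∫ ω, g (X ω) ∂μ = ∫ ω, MvPolynomial.eval (fun i => c i (X ω)) f ∂μ :=
          integral_congr_ae (ae_of_all _ fun ω => hf _ (hXσ ω))
      _ = ∫ ω, MvPolynomial.eval (fun i => c i (Y ω)) f ∂ν := h f
      _ = ∫ ω, g (Y ω) ∂ν := (integral_congr_ae (ae_of_all _ fun ω => hf _ (hYσ ω))).symm

theorem map_eq_map_of_forall_integral_eval_eq [Countable ι] {X : Ω → ι → ℂ} {Y : Ω' → ι → ℂ}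
    (hX : Measurable X) (hY : Measurable Y) {R : ℝ} (hXR : ∀ ω i, ‖X ω i‖ ≤ R)
    (hYR : ∀ ω i, ‖Y ω i‖ ≤ R) (σ : ι → ι) (hXσ : ∀ ω i, X ω (σ i) = (starRingEnd ℂ) (X ω i))
    (hYσ : ∀ ω i, Y ω (σ i) = (starRingEnd ℂ) (Y ω i))
    (h : ∀ f, ∫ ω, MvPolynomial.eval (X ω) f ∂μ = ∫ ω, MvPolynomial.eval (Y ω) f ∂ν) :
    μ.map X = ν.map Y := by
  have hcompact : CompactSpace (Metric.closedBall (0 : ℂ) R) :=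
    isCompact_iff_compactSpace.mp (isCompact_closedBall _ _)
  have hpolish : PolishSpace (Metric.closedBall (0 : ℂ) R) := Metric.isClosed_closedBall.polishSpace
  let c (i : ι) : (ι → Metric.closedBall (0 : ℂ) R) →ᵇ ℂ := mkOfCompact
    ⟨fun z => z i, continuous_subtype_val.comp (continuous_apply i)⟩
  let X' (ω : Ω) (i : ι) : Metric.closedBall (0 : ℂ) R := ⟨X ω i, by simpa using hXR ω i⟩
  let Y' (ω : Ω') (i : ι) : Metric.closedBall (0 : ℂ) R := ⟨Y ω i, by simpa using hYR ω i⟩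
  have hX' : Measurable X' :=
    measurable_pi_lambda _ fun i => ((measurable_pi_apply i).comp hX).subtype_mk
  have hY' : Measurable Y' :=
    measurable_pi_lambda _ fun i => ((measurable_pi_apply i).comp hY).subtype_mk
  have hlaw : μ.map X' = ν.map Y' :=
    map_eq_map_of_separating_of_forall_integral_eval_eq (c := c)
      (fun x y hxy => funext fun i => Subtype.ext (hxy i)) hX' hY' σ hXσ hYσ h
  have hcoe : Measurable fun (z : ι → Metric.closedBall (0 : ℂ) R) i => (z i : ℂ) :=
    measurable_pi_lambda _ fun i => measurable_subtype_coe.comp (measurable_pi_apply i)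
  have hcoeLaw := congrArg (Measure.map fun z i => (z i : ℂ)) hlaw
  rwa [Measure.map_map hcoe hX', Measure.map_map hcoe hY'] at hcoeLaw

end MomentMethod

variable {N : ℕ}

theorem norm_circlePowSum_le (u : Fin N → Circle) (k : ℤ) : ‖circlePowSum u k‖ ≤ N := by
  refine (norm_sum_le _ _).trans ?_
  simp only [Circle.norm_coe]
  simp

theorem circlePowSum_neg (u : Fin N → Circle) (k : ℤ) :
    circlePowSum u (-k) = (starRingEnd ℂ) (circlePowSum u k) := by
  simp only [circlePowSum, map_sum, ← Circle.coe_inv_eq_conj, zpow_neg]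

theorem continuous_circlePowSum : Continuous (circlePowSum : (Fin N → Circle) → ℤ → ℂ) :=
  continuous_pi fun _ => continuous_finsetSum _ fun i _ =>
    continuous_subtype_val.comp ((continuous_apply i).zpow _)

theorem continuous_powTrace :
    Continuous (powTrace : Matrix.unitaryGroup (Fin N) ℂ → ℤ → ℂ) :=
  continuous_pi fun _ => (continuous_coe_zpow _).matrix_trace

theorem map_powTrace_cue :
    (cue N).map powTrace = (weyl N).map fun θ => circlePowSum (torusExp θ) := by
  refine map_eq_map_of_forall_integral_eval_eq continuous_powTrace.measurable
    (continuous_circlePowSum.comp continuous_torusExp).measurable (R := N) ?_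
    (fun θ => norm_circlePowSum_le _) Neg.neg ?_ (fun θ => circlePowSum_neg _) fun f => ?_
  · intro U
    obtain ⟨u, hu⟩ := exists_eigenvalues U
    rw [powTrace_eq_circlePowSum hu]
    exact norm_circlePowSum_le u
  · intro U
    obtain ⟨u, hu⟩ := exists_eigenvalues U
    rw [powTrace_eq_circlePowSum hu]
    exact circlePowSum_neg u
  · rw [integral_eval_powTrace, integral_eval_circlePowSum_weyl]

end PowSumLaw

/-! ### Eigenphases as a function of the power traces -/

section Phases

theorem phase_mem (z : ℂ) : phase z ∈ Set.Ico 0 (2 * Real.pi) := by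
  simpa [phase] using toIcoMod_mem_Ico Real.two_pi_pos 0 z.arg

theorem circleExp_phase (z : Circle) : Circle.exp (phase z) = z := by
  rw [phase, toIcoMod, Circle.periodic_exp.sub_zsmul_eq, Circle.exp_arg]

theorem phase_circleExp {t : ℝ} (ht : t ∈ Set.Ico 0 (2 * Real.pi)) : phase (Circle.exp t) = t := by
  rw [phase, Circle.coe_exp, Complex.arg_exp_mul_I, toIcoMod_toIocMod, toIcoMod_eq_self]
  simpa using ht

variable {N : ℕ}

/-- The non-decreasing lists of phases in `[0, 2π)`. -/
def sortedBox (N : ℕ) : Set (Fin N → ℝ) := {θ ∈ box N | Monotone θ}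

theorem map_eigenphase (A : Matrix (Fin N) (Fin N) ℂ) :
    Finset.univ.val.map (eigenphase A) = A.charpoly.roots.map phase := by
  have hlist : List.ofFn (eigenphase A) = eigenphaseList A := by
    refine List.ext_get (by simp [length_eigenphaseList]) fun n _ _ => ?_
    simp [eigenphase]
  rw [Fin.univ_val_map, hlist, eigenphaseList, Multiset.sort_eq]

theorem monotone_eigenphase (A : Matrix (Fin N) (Fin N) ℂ) : Monotone (eigenphase A) := by
  have h := List.pairwise_iff_get.mp (Multiset.pairwise_sort (A.charpoly.roots.map phase) (· ≤ ·))
  intro i j hij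
  rcases hij.eq_or_lt with rfl | hlt
  · exact le_rfl
  · exact h _ _ hlt

theorem eigenphase_mem_sortedBox (A : Matrix (Fin N) (Fin N) ℂ) :
    eigenphase A ∈ sortedBox N := by
  refine ⟨fun i _ => ?_, monotone_eigenphase A⟩
  have h : eigenphase A i ∈ A.charpoly.roots.map phase := by
    rw [← map_eigenphase]
    exact Multiset.mem_map_of_mem _ (Finset.mem_univ_val i)
  obtain ⟨r, _, hr⟩ := Multiset.mem_map.mp h
  rw [← hr]
  exact phase_mem r

theorem roots_charpoly_eq_map_torusExp (U : Matrix.unitaryGroup (Fin N) ℂ) :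
    U.1.charpoly.roots = Finset.univ.val.map fun i => (torusExp (eigenphase U.1) i : ℂ) := by
  have h : (Finset.univ.val.map fun i => (torusExp (eigenphase U.1) i : ℂ)) =
      (Finset.univ.val.map (eigenphase U.1)).map fun t => (Circle.exp t : ℂ) := by
    rw [Multiset.map_map]; rfl
  obtain ⟨u, hu⟩ := exists_eigenvalues U
  rw [h, map_eigenphase, hu, Multiset.map_map, Multiset.map_map]
  refine Multiset.map_congr rfl fun i _ => ?_
  simp only [Function.comp_apply, circleExp_phase]

theorem sum_eval_eq_sum_eval {R ι : Type*} [CommSemiring R] [Fintype ι] {u v : ι → R}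
    (h : ∀ k : ℕ, ∑ i, u i ^ k = ∑ i, v i ^ k) (p : Polynomial R) :
    ∑ i, p.eval (u i) = ∑ i, p.eval (v i) := by
  simp only [Polynomial.eval_eq_sum_range]
  rw [Finset.sum_comm, Finset.sum_comm (s := Finset.univ)]
  simp only [← Finset.mul_sum, h]

/-- The multiplicity of `a` is read off the power sums by a polynomial that equals `1` at `a` and
vanishes at the other points. -/
theorem map_univ_eq_of_forall_sum_pow_eq {K ι : Type*} [Field K] [CharZero K] [Fintype ι]
    {u v : ι → K} (h : ∀ k : ℕ, ∑ i, u i ^ k = ∑ i, v i ^ k) :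
    Finset.univ.val.map u = Finset.univ.val.map v := by
  classical
  ext a
  set s : Finset K := insert a (Finset.univ.image u ∪ Finset.univ.image v)
  have hs : ∀ b ∈ s, (Lagrange.basis s id a).eval b = if b = a then 1 else 0 := by
    intro b hb
    split_ifs with hba
    · rw [hba]
      exact Lagrange.eval_basis_self (F := K) (v := id) Function.injective_id.injOn
        (Finset.mem_insert_self _ _)
    · exact Lagrange.eval_basis_of_ne (F := K) (v := id) (Ne.symm hba) hb
  have hcount : ∀ w : ι → K, (∀ i, w i ∈ s) →
      ∑ i, (Lagrange.basis s id a).eval (w i) = (Finset.univ.val.map w).count a := by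
    intro w hw
    simp only [hs _ (hw _), Finset.sum_boole, Multiset.count_map, eq_comm (a := a)]
    rfl
  have hsum := sum_eval_eq_sum_eval h (Lagrange.basis s id a)
  rw [hcount u fun i => by simp [s], hcount v fun i => by simp [s]] at hsum
  exact_mod_cast hsum

theorem injOn_circlePowSum_torusExp :
    Set.InjOn (fun θ => circlePowSum (torusExp θ)) (sortedBox N) := by
  intro θ hθ η hη h
  have hpow : ∀ k : ℕ, ∑ i, (torusExp θ i : ℂ) ^ k = ∑ i, (torusExp η i : ℂ) ^ k := by
    intro k
    simpa [circlePowSum] using congrFun h k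
  have hphase : ∀ ξ ∈ sortedBox N, (Finset.univ.val.map fun i => (torusExp ξ i : ℂ)).map phase =
      ((List.ofFn ξ : List ℝ) : Multiset ℝ) := by
    intro ξ hξ
    rw [Multiset.map_map, ← Fin.univ_val_map]
    exact Multiset.map_congr rfl fun i _ => phase_circleExp (hξ.1 i trivial)
  have hpairwise : ∀ ξ ∈ sortedBox N, (List.ofFn ξ).Pairwise (· ≤ ·) := by
    intro ξ hξ
    rw [List.pairwise_ofFn]
    exact fun i j hij => hξ.2 hij.le
  have hperm := congrArg (Multiset.map phase) (map_univ_eq_of_forall_sum_pow_eq hpow)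
  rw [hphase θ hθ, hphase η hη, Multiset.coe_eq_coe] at hperm
  exact List.ofFn_injective (hperm.eq_of_pairwise (fun a b _ _ h h' => le_antisymm h h')
    (hpairwise θ hθ) (hpairwise η hη))

theorem measurableSet_sortedBox : MeasurableSet (sortedBox N) :=
  measurableSet_box.inter isClosed_monotone.measurableSet

theorem exists_measurable_sortedPhases : ∃ F : (ℤ → ℂ) → Fin N → ℝ, Measurable F ∧
    ∀ θ ∈ sortedBox N, F (circlePowSum (torusExp θ)) = θ := by
  have hcont : Continuous fun θ : Fin N → ℝ => circlePowSum (torusExp θ) :=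
    continuous_circlePowSum.comp continuous_torusExp
  obtain ⟨F, hF, hFcomp⟩ := (hcont.continuousOn.measurableEmbedding measurableSet_sortedBox
    injOn_circlePowSum_torusExp).exists_measurable_extend measurable_subtype_coe
    fun _ => inferInstance
  exact ⟨F, hF, fun θ hθ => congrFun hFcomp ⟨θ, hθ⟩⟩

end Phases

/-! ### The law of the ordered eigenphases -/

section Symmetrization

variable {α : Type*} {n : ℕ}

theorem sum_indicator_strictMono_comp_perm [LinearOrder α] {f : (Fin n → α) → ENNReal}
    (hf : ∀ (σ : Equiv.Perm (Fin n)) θ, f (θ ∘ σ) = f θ)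
    (hf0 : ∀ θ, ¬ Function.Injective θ → f θ = 0) (θ : Fin n → α) :
    ∑ σ : Equiv.Perm (Fin n), {θ | StrictMono θ}.indicator f (θ ∘ σ) = f θ := by
  classical
  simp only [Set.indicator_apply, hf, Set.mem_ofPred_eq]
  by_cases hinj : Function.Injective θ
  · have hmono := Tuple.monotone_sort θ
    rw [Finset.sum_eq_single (Tuple.sort θ)]
    · rw [if_pos (hmono.strictMono_of_injective (hinj.comp (Tuple.sort θ).injective))]
    · intro τ _ hτ
      refine if_neg fun hstrict => hτ ?_
      ext i
      exact congrArg Fin.val (hinj (congrFun (Tuple.unique_monotone hstrict.monotone hmono) i))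
    · simp
  · simp [hf0 θ hinj]

variable [LinearOrder α] [TopologicalSpace α] [OrderClosedTopology α] [SecondCountableTopology α]
  [MeasureSpace α] [OpensMeasurableSpace α]

theorem measurableSet_strictMono : MeasurableSet {θ : Fin n → α | StrictMono θ} := by
  have : {θ : Fin n → α | StrictMono θ} = ⋂ (i) (j) (_ : i < j), {θ | θ i < θ j} := by
    ext θ; simp [StrictMono]
  rw [this]
  exact MeasurableSet.iInter fun i => MeasurableSet.iInter fun j => MeasurableSet.iInter fun _ =>
    measurableSet_lt (measurable_pi_apply i) (measurable_pi_apply j)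

theorem lintegral_eq_factorial_mul_setLIntegral_strictMono [SigmaFinite (volume : Measure α)]
    {f : (Fin n → α) → ENNReal} (hfm : Measurable f)
    (hf : ∀ (σ : Equiv.Perm (Fin n)) θ, f (θ ∘ σ) = f θ)
    (hf0 : ∀ θ, ¬ Function.Injective θ → f θ = 0) :
    ∫⁻ θ, f θ = n.factorial * ∫⁻ θ in {θ | StrictMono θ}, f θ := by
  have hind : Measurable ({θ : Fin n → α | StrictMono θ}.indicator f) :=
    hfm.indicator measurableSet_strictMono
  have hperm : ∀ σ : Equiv.Perm (Fin n), ∫⁻ θ, {θ | StrictMono θ}.indicator f (θ ∘ σ) =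
      ∫⁻ θ, {θ | StrictMono θ}.indicator f θ := fun σ =>
    (volume_preserving_arrowCongr' σ.symm (MeasurableEquiv.refl α)
      (MeasurePreserving.id _)).lintegral_comp hind
  calc ∫⁻ θ, f θ
      = ∫⁻ θ, ∑ σ : Equiv.Perm (Fin n), {θ | StrictMono θ}.indicator f (θ ∘ σ) := by
        simp only [sum_indicator_strictMono_comp_perm hf hf0]
    _ = ∑ _σ : Equiv.Perm (Fin n), ∫⁻ θ, {θ | StrictMono θ}.indicator f θ := by
        rw [lintegral_finsetSum]
        · simp only [hperm]
        · exact fun σ _ => hind.comp (measurable_pi_lambda _ fun i => measurable_pi_apply (σ i))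
    _ = n.factorial * ∫⁻ θ in {θ | StrictMono θ}, f θ := by
        rw [Finset.sum_const, Finset.card_univ, Fintype.card_perm, Fintype.card_fin, nsmul_eq_mul,
          lintegral_indicator measurableSet_strictMono]

end Symmetrization

section OrderedEigenphases

variable {N : ℕ}

theorem evalAt_vander (u : Fin N → Circle) :
    evalAt u vander = ∏ i, ∏ j ∈ Finset.Ioi i, ((u j : ℂ) - u i) := by
  simp only [vander, Matrix.det_vandermonde, map_prod, map_sub, evalAt_mono, zpow_one]

theorem evalAt_permAct (u : Fin N → Circle) (σ : Equiv.Perm (Fin N)) (x : Laurent N) :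
    evalAt (u ∘ σ) (permAct σ x) = evalAt u x := by
  induction x using AddMonoidAlgebra.induction_linear with
  | zero => simp
  | add x y hx hy => simp only [map_add, hx, hy]
  | single m a =>
    rw [permAct_single, evalAt_single, evalAt_single]
    congr 2
    exact Equiv.prod_comp σ fun i => u i ^ m i

theorem vanderSq_comp_perm (σ : Equiv.Perm (Fin N)) (θ : Fin N → ℝ) :
    vanderSq (θ ∘ σ) = vanderSq θ := by
  have h := evalAt_permAct (torusExp θ) σ vander
  rw [permAct_vander, map_smul, smul_eq_mul] at h
  rw [vanderSq, vanderSq, ← h, map_mul]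
  change Complex.normSq (evalAt (torusExp θ ∘ σ) vander) = _
  rcases Int.units_eq_one_or (Equiv.Perm.sign σ) with hs | hs <;> simp [hs]

theorem vanderSq_eq_zero {θ : Fin N → ℝ} (hθ : ¬ Function.Injective θ) : vanderSq θ = 0 := by
  obtain ⟨i, j, hij, hlt⟩ : ∃ i j, θ i = θ j ∧ i < j := by
    obtain ⟨i, j, hij, hne⟩ := Function.not_injective_iff.mp hθ
    rcases hne.lt_or_gt with hlt | hlt
    exacts [⟨i, j, hij, hlt⟩, ⟨j, i, hij.symm, hlt⟩]
  rw [vanderSq, Complex.normSq_eq_zero, evalAt_vander]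
  refine Finset.prod_eq_zero (Finset.mem_univ i) (Finset.prod_eq_zero (Finset.mem_Ioi.mpr hlt) ?_)
  rw [torusExp, torusExp, hij, sub_self]

theorem circlePowSum_comp_perm (u : Fin N → Circle) (σ : Equiv.Perm (Fin N)) :
    circlePowSum (u ∘ σ) = circlePowSum u := by
  ext k
  exact Equiv.sum_comp σ fun i => ((u i ^ k : Circle) : ℂ)

theorem comp_perm_mem_box_iff {θ : Fin N → ℝ} (σ : Equiv.Perm (Fin N)) :
    θ ∘ σ ∈ box N ↔ θ ∈ box N := by
  simp only [box, Set.mem_univ_pi, Function.comp_apply]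
  exact ⟨fun h i => by simpa using h (σ.symm i), fun h i => h _⟩

/-- The increasing lists of phases in `[0, 2π)`. -/
def strictBox (N : ℕ) : Set (Fin N → ℝ) := {θ ∈ box N | StrictMono θ}

theorem measurableSet_strictBox : MeasurableSet (strictBox N) :=
  measurableSet_box.inter measurableSet_strictMono

/-- The joint law of the eigenphases in increasing order. -/
noncomputable def orderedWeyl (N : ℕ) : Measure (Fin N → ℝ) :=
  (volume.restrict (strictBox N)).withDensity fun θ =>
    ENNReal.ofReal (vanderSq θ / (2 * Real.pi) ^ N)

theorem preimage_inter_box_inter_strictMono {G : (Fin N → ℝ) → Fin N → ℝ}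
    (hG : ∀ θ ∈ sortedBox N, G θ = θ) (A : Set (Fin N → ℝ)) :
    G ⁻¹' A ∩ box N ∩ {θ | StrictMono θ} = A ∩ strictBox N := by
  ext θ
  constructor
  · rintro ⟨⟨hGA, hbox⟩, hmono⟩
    rw [Set.mem_preimage, hG θ ⟨hbox, hmono.monotone⟩] at hGA
    exact ⟨hGA, hbox, hmono⟩
  · rintro ⟨hA, hbox, hmono⟩
    refine ⟨⟨?_, hbox⟩, hmono⟩
    rwa [Set.mem_preimage, hG θ ⟨hbox, hmono.monotone⟩]

theorem map_weyl_eq_orderedWeyl {G : (Fin N → ℝ) → Fin N → ℝ} (hG : Measurable G)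
    (hperm : ∀ (σ : Equiv.Perm (Fin N)) θ, G (θ ∘ σ) = G θ)
    (hsorted : ∀ θ ∈ sortedBox N, G θ = θ) : (weyl N).map G = orderedWeyl N := by
  ext A hA
  set w : (Fin N → ℝ) → ENNReal := fun θ =>
    ENNReal.ofReal (vanderSq θ / (N.factorial * (2 * Real.pi) ^ N))
  have hw : Measurable w := (continuous_vanderSq.div_const _).measurable.ennreal_ofReal
  have hs : MeasurableSet (G ⁻¹' A ∩ box N) := (hG hA).inter measurableSet_box
  calc (weyl N).map G A
      = ∫⁻ θ, (G ⁻¹' A ∩ box N).indicator w θ := by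
        rw [Measure.map_apply hG hA, weyl, withDensity_apply _ (hG hA),
          Measure.restrict_restrict (hG hA), lintegral_indicator hs]
    _ = N.factorial * ∫⁻ θ in {θ | StrictMono θ}, (G ⁻¹' A ∩ box N).indicator w θ := by
        refine lintegral_eq_factorial_mul_setLIntegral_strictMono (hw.indicator hs) ?_ ?_
        · intro σ θ
          classical
          simp only [Set.indicator_apply, Set.mem_inter_iff, Set.mem_preimage, hperm,
            comp_perm_mem_box_iff, w, vanderSq_comp_perm]
        · intro θ hθ
          simp [w, vanderSq_eq_zero hθ]
    _ = ∫⁻ θ in A ∩ strictBox N, N.factorial * w θ := by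
        rw [setLIntegral_indicator hs, preimage_inter_box_inter_strictMono hsorted,
          lintegral_const_mul _ hw]
    _ = orderedWeyl N A := by
        rw [orderedWeyl, withDensity_apply _ hA, Measure.restrict_restrict hA]
        refine lintegral_congr fun θ => ?_
        rw [← ENNReal.ofReal_natCast, ← ENNReal.ofReal_mul (by positivity)]
        have := N.factorial_ne_zero
        field_simp

theorem exists_measurable_eigenphase_eq :
    ∃ F : (ℤ → ℂ) → Fin N → ℝ, Measurable F ∧
      (∀ U : Matrix.unitaryGroup (Fin N) ℂ, eigenphase U.1 = F (powTrace U)) ∧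
      ∀ θ ∈ sortedBox N, F (circlePowSum (torusExp θ)) = θ := by
  obtain ⟨F, hF, hFsorted⟩ := exists_measurable_sortedPhases (N := N)
  refine ⟨F, hF, fun U => ?_, hFsorted⟩
  rw [powTrace_eq_circlePowSum (roots_charpoly_eq_map_torusExp U),
    hFsorted _ (eigenphase_mem_sortedBox U.1)]

theorem measurable_eigenphase :
    Measurable fun U : Matrix.unitaryGroup (Fin N) ℂ => eigenphase U.1 := by
  obtain ⟨F, hF, hFU, -⟩ := exists_measurable_eigenphase_eq (N := N)
  simp only [hFU]
  exact hF.comp continuous_powTrace.measurable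

theorem map_eigenphase_cue :
    (cue N).map (fun U => eigenphase U.1) = orderedWeyl N := by
  obtain ⟨F, hF, hFU, hFsorted⟩ := exists_measurable_eigenphase_eq (N := N)
  have hcont : Continuous fun θ : Fin N → ℝ => circlePowSum (torusExp θ) :=
    continuous_circlePowSum.comp continuous_torusExp
  simp only [hFU]
  rw [← Function.comp_def F, ← Measure.map_map hF continuous_powTrace.measurable,
    map_powTrace_cue, Measure.map_map hF hcont.measurable]
  exact map_weyl_eq_orderedWeyl (hF.comp hcont.measurable)
    (fun σ θ => congrArg F (circlePowSum_comp_perm (torusExp θ) σ)) hFsorted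

end OrderedEigenphases

section MinGap

variable {N : ℕ} [NeZero N]

/-- The minimal spacing of an ordered list of phases, in units of the mean spacing `2π / N`. -/
noncomputable def minGap (φ : Fin N → ℝ) : ℝ :=
  Finset.univ.inf' Finset.univ_nonempty fun j : Fin N =>
    (if h : (j : ℕ) + 1 < N then φ ⟨j + 1, h⟩ - φ j else 2 * Real.pi + φ ⟨0, j.pos⟩ - φ j) /
      (2 * Real.pi / N)

theorem continuous_minGap : Continuous (minGap : (Fin N → ℝ) → ℝ) := by
  refine Continuous.finset_inf'_apply _ fun j _ => ?_
  split_ifs with h <;> fun_prop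

theorem measurable_sMin : Measurable fun U : Matrix.unitaryGroup (Fin N) ℂ => sMin U.1 :=
  continuous_minGap.measurable.comp measurable_eigenphase

theorem map_sMin_cue :
    (cue N).map (fun U => sMin U.1) = (orderedWeyl N).map minGap := by
  rw [← map_eigenphase_cue, Measure.map_map continuous_minGap.measurable measurable_eigenphase]
  rfl

end MinGap

/-! ### Cyclic symmetry of the four gaps -/

section Measure

variable {α : Type*} [MeasurableSpace α] {μ : Measure α}

theorem lintegral_sum_iterate_mul {T : α → α} (hT : MeasurePreserving T μ μ) {g h : α → ENNReal}
    (hg : Measurable g) (hh : Measurable h) (hTh : ∀ x, h (T x) = h x) (n : ℕ) :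
    ∫⁻ x, (∑ k ∈ Finset.range n, g (T^[k] x)) * h x ∂μ = n * ∫⁻ x, g x * h x ∂μ := by
  have hiter : ∀ k x, h (T^[k] x) = h x := fun k x => by
    induction k with
    | zero => rfl
    | succ k ih => rw [Function.iterate_succ_apply', hTh, ih]
  have hterm : ∀ k, ∫⁻ x, g (T^[k] x) * h x ∂μ = ∫⁻ x, g x * h x ∂μ := fun k => by
    rw [← (hT.iterate k).lintegral_comp (f := fun x => g x * h x) (hg.mul hh)]
    simp only [hiter]
  simp only [Finset.sum_mul]
  rw [lintegral_finsetSum (f := fun k x => g (T^[k] x) * h x) _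
    fun k _ => (hg.comp (hT.measurable.iterate k)).mul hh]
  simp only [hterm, Finset.sum_const, Finset.card_range, nsmul_eq_mul]

theorem setLIntegral_snd_Ico [SFinite μ] {s : Set α} (hs : MeasurableSet s) {w : α → ℝ}
    (hw : Measurable w) {h : α → ENNReal} (hh : Measurable h) :
    ∫⁻ p in {p | p.2 ∈ s ∧ p.1 ∈ Set.Ico 0 (w p.2)}, h p.2 ∂(volume : Measure ℝ).prod μ =
      ∫⁻ q in s, ENNReal.ofReal (w q) * h q ∂μ := by
  have hmeas : MeasurableSet {p : ℝ × α | p.2 ∈ s ∧ p.1 ∈ Set.Ico 0 (w p.2)} :=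
    (measurable_snd hs).inter ((measurableSet_le measurable_const measurable_fst).inter
      (measurableSet_lt measurable_fst (hw.comp measurable_snd)))
  rw [← lintegral_indicator hmeas, ← lintegral_indicator hs,
    lintegral_prod_symm' (f := Set.indicator _ fun p => h p.2)
      ((hh.comp measurable_snd).indicator hmeas)]
  refine lintegral_congr fun q => ?_
  by_cases hq : q ∈ s
  · rw [Set.indicator_of_mem hq, mul_comm, ← sub_zero (w q), ← Real.volume_Ico,
      ← lintegral_indicator_const measurableSet_Ico]
    exact lintegral_congr fun a => Set.indicator_eq_indicator (by simp [hq]) rfl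
  · simp [hq]

theorem ae_fst_ne [SFinite μ] {φ : α → ℝ} (hφ : Measurable φ) :
    ∀ᵐ p ∂(volume : Measure ℝ).prod μ, p.1 ≠ φ p.2 := by
  have hmeas : MeasurableSet {p : ℝ × α | p.1 = φ p.2} :=
    measurableSet_eq_fun measurable_fst (hφ.comp measurable_snd)
  rw [ae_iff]
  simp only [ne_eq, not_not]
  rw [Measure.prod_apply_symm hmeas]
  exact (lintegral_congr fun q => measure_singleton (φ q)).trans lintegral_zero

end Measure

/-- The last gap around the circle, given the first three. -/
noncomputable def lastGap (q : ℝ × ℝ × ℝ) : ℝ := 2 * Real.pi - q.1 - q.2.1 - q.2.2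

/-- The cyclic rotation of the four gaps. -/
noncomputable def rotGap (q : ℝ × ℝ × ℝ) : ℝ × ℝ × ℝ := (lastGap q, q.1, q.2.1)

/-- The squared length of the chord over an arc of the unit circle. -/
noncomputable def chord (t : ℝ) : ℝ := 2 - 2 * Real.cos t

/-- The squared Vandermonde determinant of four points of the circle in terms of their gaps. -/
noncomputable def gapDensity (q : ℝ × ℝ × ℝ) : ℝ :=
  chord q.1 * chord q.2.1 * chord q.2.2 * chord (q.1 + q.2.1) * chord (q.2.1 + q.2.2) *
    chord (q.1 + q.2.1 + q.2.2)

/-- The smallest of the four gaps. -/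
noncomputable def smallGap (q : ℝ × ℝ × ℝ) : ℝ := min (min q.1 q.2.1) (min q.2.2 (lastGap q))

/-- The configurations of four positive gaps. -/
def gapSimplex : Set (ℝ × ℝ × ℝ) := {q | 0 < q.1 ∧ 0 < q.2.1 ∧ 0 < q.2.2 ∧ 0 < lastGap q}

/-- The configurations whose first gap is strictly the smallest one. -/
def firstMin : Set (ℝ × ℝ × ℝ) := {q | q.1 < q.2.1 ∧ q.1 < q.2.2 ∧ q.1 < lastGap q}

@[fun_prop]
theorem continuous_lastGap : Continuous lastGap := by unfold lastGap; fun_prop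

@[fun_prop]
theorem continuous_gapDensity : Continuous gapDensity := by unfold gapDensity chord; fun_prop

@[fun_prop]
theorem continuous_smallGap : Continuous smallGap := by unfold smallGap; fun_prop

theorem measurableSet_gapSimplex : MeasurableSet gapSimplex := by
  refine IsOpen.measurableSet ?_
  simp only [gapSimplex, Set.ofPred_and]
  repeat' first | apply IsOpen.inter | exact isOpen_lt (by fun_prop) (by fun_prop)

theorem measurableSet_firstMin : MeasurableSet firstMin := by
  refine IsOpen.measurableSet ?_
  simp only [firstMin, Set.ofPred_and]
  repeat' first | apply IsOpen.inter | exact isOpen_lt (by fun_prop) (by fun_prop)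

theorem chord_two_pi_sub (t : ℝ) : chord (2 * Real.pi - t) = chord t := by
  rw [chord, Real.cos_two_pi_sub, chord]

theorem gapDensity_rotGap (q : ℝ × ℝ × ℝ) : gapDensity (rotGap q) = gapDensity q := by
  obtain ⟨x, y, z⟩ := q
  simp only [gapDensity, rotGap, lastGap]
  rw [show 2 * Real.pi - x - y - z + x + y = 2 * Real.pi - z by ring,
    show 2 * Real.pi - x - y - z + x = 2 * Real.pi - (y + z) by ring,
    show 2 * Real.pi - x - y - z = 2 * Real.pi - (x + y + z) by ring]
  simp only [chord_two_pi_sub]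
  ring

theorem rotGap_fst (q : ℝ × ℝ × ℝ) : (rotGap q).1 = lastGap q := rfl

theorem rotGap_snd_fst (q : ℝ × ℝ × ℝ) : (rotGap q).2.1 = q.1 := rfl

theorem rotGap_snd_snd (q : ℝ × ℝ × ℝ) : (rotGap q).2.2 = q.2.1 := rfl

theorem lastGap_rotGap (q : ℝ × ℝ × ℝ) : lastGap (rotGap q) = q.2.2 := by
  simp only [lastGap, rotGap]; ring

theorem smallGap_rotGap (q : ℝ × ℝ × ℝ) : smallGap (rotGap q) = smallGap q := by
  simp only [smallGap, rotGap_fst, rotGap_snd_fst, rotGap_snd_snd, lastGap_rotGap]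
  ac_rfl

theorem rotGap_preimage_gapSimplex : rotGap ⁻¹' gapSimplex = gapSimplex := by
  ext q
  simp only [gapSimplex, Set.mem_preimage, Set.mem_ofPred_eq, lastGap_rotGap, rotGap_fst,
    rotGap_snd_fst, rotGap_snd_snd]
  tauto

theorem measurePreserving_rotGap : MeasurePreserving rotGap := by
  have hshear : MeasurePreserving
      fun p : (ℝ × ℝ) × ℝ => (p.1, 2 * Real.pi - p.1.1 - p.1.2 - p.2) :=
    (MeasurePreserving.id volume).skew_product
      (g := fun (p : ℝ × ℝ) z => 2 * Real.pi - p.1 - p.2 - z) (by unfold Function.uncurry; fun_prop)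
      (ae_of_all _ fun p =>
        (Measure.measurePreserving_sub_left volume (2 * Real.pi - p.1 - p.2)).map_eq)
  exact Measure.measurePreserving_swap.comp
    (hshear.comp (volume_preserving_prodAssoc (α₁ := ℝ) (β₁ := ℝ) (γ₁ := ℝ)).symm)

theorem measurePreserving_rotGap_restrict :
    MeasurePreserving rotGap (volume.restrict gapSimplex) (volume.restrict gapSimplex) := by
  have h := measurePreserving_rotGap.restrict_preimage measurableSet_gapSimplex
  rwa [rotGap_preimage_gapSimplex] at h

theorem sum_lastGap_iterate_rotGap {q : ℝ × ℝ × ℝ} (hq : q ∈ gapSimplex) :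
    ∑ k ∈ Finset.range 4, ENNReal.ofReal (lastGap (rotGap^[k] q)) =
      ENNReal.ofReal (2 * Real.pi) := by
  obtain ⟨hx, hy, hz, hw⟩ := hq
  simp only [Finset.sum_range_succ, Finset.range_zero, Finset.sum_empty, zero_add,
    Function.iterate_succ, Function.iterate_zero, Function.comp_apply, id, lastGap_rotGap,
    rotGap_snd_snd, rotGap_snd_fst]
  rw [← ENNReal.ofReal_add hw.le hz.le, ← ENNReal.ofReal_add (by positivity) hy.le,
    ← ENNReal.ofReal_add (by positivity) hx.le, lastGap]
  ring_nf

theorem ae_fst_ne_gaps :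
    ∀ᵐ q : ℝ × ℝ × ℝ, q.1 ≠ q.2.1 ∧ q.1 ≠ q.2.2 ∧ q.1 ≠ lastGap q := by
  have hlast : ∀ᵐ q : ℝ × ℝ × ℝ, q.1 ≠ (2 * Real.pi - q.2.1 - q.2.2) / 2 :=
    ae_fst_ne (φ := fun p : ℝ × ℝ => (2 * Real.pi - p.1 - p.2) / 2) (by fun_prop)
  filter_upwards [ae_fst_ne measurable_fst, ae_fst_ne measurable_snd, hlast] with q hy hz hw
  refine ⟨hy, hz, fun h => hw ?_⟩
  rw [lastGap] at h
  linarith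

theorem exists_strict_min {x y z w : ℝ} (hx : x ≠ y ∧ x ≠ z ∧ x ≠ w) (hw : w ≠ x ∧ w ≠ y ∧ w ≠ z)
    (hz : z ≠ w ∧ z ≠ x ∧ z ≠ y) :
    (x < y ∧ x < z ∧ x < w) ∨ (w < x ∧ w < y ∧ w < z) ∨ (z < w ∧ z < x ∧ z < y) ∨
      (y < z ∧ y < w ∧ y < x) := by
  grind

theorem ae_sum_indicator_firstMin_iterate_rotGap :
    ∀ᵐ q : ℝ × ℝ × ℝ,
      ∑ k ∈ Finset.range 4, firstMin.indicator (1 : ℝ × ℝ × ℝ → ENNReal) (rotGap^[k] q) = 1 := by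
  have hrot := measurePreserving_rotGap.quasiMeasurePreserving
  filter_upwards [ae_fst_ne_gaps, hrot.ae ae_fst_ne_gaps, (hrot.comp hrot).ae ae_fst_ne_gaps]
    with q h0 h1 h2
  simp only [Function.comp_apply, lastGap_rotGap, rotGap_fst, rotGap_snd_fst, rotGap_snd_snd]
    at h1 h2
  simp only [Finset.sum_range_succ, Finset.range_zero, Finset.sum_empty, zero_add,
    Function.iterate_succ, Function.iterate_zero, Function.comp_apply, id, Set.indicator_apply,
    firstMin, Set.mem_ofPred_eq, lastGap_rotGap, rotGap_fst, rotGap_snd_fst, rotGap_snd_snd,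
    Pi.one_apply]
  rcases exists_strict_min h0 h1 h2 with h | h | h | h <;>
    simp [h, h.1.not_gt, h.2.1.not_gt, h.2.2.not_gt]

theorem lintegral_lastGap_mul {h : ℝ × ℝ × ℝ → ENNReal} (hh : Measurable h)
    (hrot : ∀ q, h (rotGap q) = h q) :
    ∫⁻ q in gapSimplex, ENNReal.ofReal (lastGap q) * h q =
      ENNReal.ofReal (2 * Real.pi) * ∫⁻ q in gapSimplex ∩ firstMin, h q := by
  have hmean : ∀ {g : ℝ × ℝ × ℝ → ENNReal}, Measurable g →
      ∫⁻ q in gapSimplex, (∑ k ∈ Finset.range 4, g (rotGap^[k] q)) * h q =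
        4 * ∫⁻ q in gapSimplex, g q * h q := fun hg => by
    exact_mod_cast lintegral_sum_iterate_mul measurePreserving_rotGap_restrict hg hh hrot 4
  have hlast : ∫⁻ q in gapSimplex, ENNReal.ofReal (2 * Real.pi) * h q =
      4 * ∫⁻ q in gapSimplex, ENNReal.ofReal (lastGap q) * h q := by
    rw [← hmean (g := fun q => ENNReal.ofReal (lastGap q)) (by fun_prop)]
    exact setLIntegral_congr_fun measurableSet_gapSimplex fun q hq => by
      simp only [sum_lastGap_iterate_rotGap hq]
  have hfirst : ∫⁻ q in gapSimplex, h q = 4 * ∫⁻ q in gapSimplex ∩ firstMin, h q := by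
    have hind : ∫⁻ q in gapSimplex ∩ firstMin, h q =
        ∫⁻ q in gapSimplex, firstMin.indicator 1 q * h q := by
      rw [Set.inter_comm, ← setLIntegral_indicator measurableSet_firstMin]
      exact lintegral_congr fun q => by by_cases hq : q ∈ firstMin <;> simp [hq]
    rw [hind, ← hmean (measurable_one.indicator measurableSet_firstMin)]
    refine lintegral_congr_ae (ae_restrict_of_ae ?_)
    filter_upwards [ae_sum_indicator_firstMin_iterate_rotGap] with q hq
    rw [hq, one_mul]
  rw [lintegral_const_mul _ hh, hfirst, mul_left_comm] at hlast
  exact ((ENNReal.mul_right_inj four_ne_zero (by finiteness)).1 hlast).symm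

/-! ### From ordered phases to gaps -/

theorem lintegral_fin_succ {n : ℕ} {f : (Fin (n + 1) → ℝ) → ENNReal} (hf : Measurable f) :
    ∫⁻ θ, f θ = ∫⁻ a : ℝ, ∫⁻ η : Fin n → ℝ, f (Matrix.vecCons a η) := by
  have h := (volume_preserving_piFinSuccAbove (fun _ : Fin (n + 1) => ℝ) 0).symm
  rw [← h.lintegral_comp hf, Measure.volume_eq_prod]
  refine (lintegral_prod (μ := volume) (ν := volume) _
    (hf.comp h.measurable).aemeasurable).trans ?_
  refine lintegral_congr fun a => lintegral_congr fun η => congrArg f (funext fun i => ?_)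
  refine Fin.cases ?_ (fun j => ?_) i <;> rfl

theorem lintegral_fin_four {f : (Fin 4 → ℝ) → ENNReal} (hf : Measurable f) :
    ∫⁻ θ, f θ = ∫⁻ (a : ℝ) (b : ℝ) (c : ℝ) (d : ℝ), f ![a, b, c, d] := by
  have hcons : ∀ {n : ℕ} (a : ℝ), Measurable fun η : Fin n → ℝ => Matrix.vecCons a η :=
    fun a => (continuous_const.matrixVecCons continuous_id).measurable
  rw [lintegral_fin_succ hf]
  refine lintegral_congr fun a => (lintegral_fin_succ (hf.comp (hcons a))).trans ?_
  refine lintegral_congr fun b =>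
    (lintegral_fin_succ ((hf.comp (hcons a)).comp (hcons b))).trans ?_
  refine lintegral_congr fun c =>
    (lintegral_fin_succ (((hf.comp (hcons a)).comp (hcons b)).comp (hcons c))).trans ?_
  refine lintegral_congr fun d => ?_
  rw [lintegral_unique, volume_pi, Measure.pi_of_empty]
  simp [Matrix.empty_eq]

/-- The four phases with first phase `p.1` and successive gaps `p.2`. -/
def phasesOfGaps (p : ℝ × ℝ × ℝ × ℝ) : Fin 4 → ℝ :=
  ![p.1, p.1 + p.2.1, p.1 + p.2.1 + p.2.2.1, p.1 + p.2.1 + p.2.2.1 + p.2.2.2]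

theorem measurable_phasesOfGaps : Measurable phasesOfGaps := by
  unfold phasesOfGaps
  exact Continuous.measurable (by fun_prop)

theorem measurePreserving_phasesOfGaps : MeasurePreserving phasesOfGaps := by
  refine ⟨measurable_phasesOfGaps, Measure.ext_of_lintegral _ fun f hf => ?_⟩
  rw [lintegral_map hf measurable_phasesOfGaps]
  have hfp := hf.comp measurable_phasesOfGaps
  rw [lintegral_fin_four hf]
  refine (lintegral_prod _ hfp.aemeasurable).trans ?_
  refine lintegral_congr fun a => ?_
  rw [← lintegral_add_left_eq_self _ a]
  refine (lintegral_prod _ (hfp.comp measurable_prodMk_left).aemeasurable).trans ?_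
  refine lintegral_congr fun x => ?_
  rw [← lintegral_add_left_eq_self _ (a + x)]
  refine (lintegral_prod _
    ((hfp.comp measurable_prodMk_left).comp measurable_prodMk_left).aemeasurable).trans ?_
  refine lintegral_congr fun y => ?_
  exact lintegral_add_left_eq_self (fun d => f ![a, a + x, a + x + y, d]) (a + x + y)

theorem normSq_circleExp_sub (s t : ℝ) :
    Complex.normSq ((Circle.exp s : ℂ) - Circle.exp t) = chord (s - t) := by
  rw [Circle.coe_exp, Circle.coe_exp, Complex.normSq_apply, chord, Real.cos_sub]
  simp only [Complex.sub_re, Complex.sub_im, Complex.exp_ofReal_mul_I_re,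
    Complex.exp_ofReal_mul_I_im]
  linear_combination Real.sin_sq_add_cos_sq s + Real.sin_sq_add_cos_sq t

theorem vanderSq_eq_prod_chord {N : ℕ} (θ : Fin N → ℝ) :
    vanderSq θ = ∏ i, ∏ j ∈ Finset.Ioi i, chord (θ j - θ i) := by
  simp only [vanderSq, evalAt_vander, map_prod, torusExp, normSq_circleExp_sub]

theorem vanderSq_phasesOfGaps (p : ℝ × ℝ × ℝ × ℝ) :
    vanderSq (phasesOfGaps p) = gapDensity p.2 := by
  obtain ⟨a, x, y, z⟩ := p
  simp only [vanderSq_eq_prod_chord, Fin.prod_univ_succ, Fin.prod_Ioi_zero, Fin.prod_Ioi_succ,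
    Finset.univ_eq_empty, Finset.prod_empty, phasesOfGaps, Matrix.cons_val_zero,
    Matrix.cons_val_succ, gapDensity]
  ring_nf

theorem minGap_phasesOfGaps (p : ℝ × ℝ × ℝ × ℝ) :
    minGap (phasesOfGaps p) = smallGap p.2 / (Real.pi / 2) := by
  obtain ⟨a, x, y, z⟩ := p
  have hunit : (0 : ℝ) < 2 * Real.pi / (4 : ℕ) := by have := Real.pi_pos; positivity
  have hhalf : Real.pi / 2 = 2 * Real.pi / (4 : ℕ) := by push_cast; ring
  refine eq_of_forall_le_iff fun c => ?_
  simp only [minGap, Finset.le_inf'_iff, hhalf, le_div_iff₀ hunit, Finset.mem_univ, true_implies,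
    smallGap, lastGap, le_min_iff]
  generalize c * (2 * Real.pi / (4 : ℕ)) = d
  simp only [phasesOfGaps, Fin.forall_fin_succ, Fin.isValue, Fin.coe_ofNat_eq_mod, Nat.zero_mod,
    zero_add, Nat.one_lt_ofNat, ↓reduceDIte, Fin.mk_one, Matrix.cons_val_one, Matrix.cons_val_zero,
    Fin.succ_zero_eq_one, Nat.reduceAdd, Nat.reduceLT, Fin.reduceFinMk,
    Matrix.cons_val, Fin.succ_one_eq_two, Nat.lt_add_one, Fin.reduceSucc,
    Nat.mod_succ, lt_self_iff_false, Fin.zero_eta, Fin.val_succ, IsEmpty.forall_iff, and_true]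
  grind

theorem phasesOfGaps_mem_strictBox_iff (p : ℝ × ℝ × ℝ × ℝ) :
    phasesOfGaps p ∈ strictBox 4 ↔ p.2 ∈ gapSimplex ∧ p.1 ∈ Set.Ico 0 (lastGap p.2) := by
  obtain ⟨a, x, y, z⟩ := p
  rw [strictBox, Set.mem_sep_iff, Fin.strictMono_iff_lt_succ]
  simp only [box, Set.mem_univ_pi, Set.mem_Ico, Fin.forall_fin_succ, phasesOfGaps, gapSimplex,
    lastGap, Set.mem_ofPred_eq, Fin.isValue, Matrix.cons_val_zero, Fin.succ_zero_eq_one,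
    Matrix.cons_val_one, Fin.succ_one_eq_two, Matrix.cons_val, Matrix.cons_val_succ,
    IsEmpty.forall_iff, and_true, Fin.castSucc_zero, Fin.castSucc_one, Fin.reduceCastSucc]
  grind

theorem lintegral_orderedWeyl {f : ℝ → ENNReal} (hf : Measurable f) :
    ∫⁻ θ, f (minGap θ) ∂orderedWeyl 4 =
      ENNReal.ofReal (1 / (2 * Real.pi) ^ 4) * ∫⁻ q in gapSimplex,
        ENNReal.ofReal (lastGap q) *
          (f (smallGap q / (Real.pi / 2)) * ENNReal.ofReal (gapDensity q)) := by
  have hvander : Measurable fun θ : Fin 4 → ℝ => ENNReal.ofReal (vanderSq θ / (2 * Real.pi) ^ 4) :=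
    (continuous_vanderSq.div_const _).measurable.ennreal_ofReal
  have hfmin : Measurable fun θ : Fin 4 → ℝ => f (minGap θ) :=
    hf.comp continuous_minGap.measurable
  have hweight : Measurable fun q : ℝ × ℝ × ℝ =>
      f (smallGap q / (Real.pi / 2)) * ENNReal.ofReal (gapDensity q) := by fun_prop
  rw [orderedWeyl, lintegral_withDensity_eq_lintegral_mul _ hvander hfmin,
    ← measurePreserving_phasesOfGaps.setLIntegral_comp_preimage measurableSet_strictBox
      (hvander.mul hfmin),
    ← setLIntegral_snd_Ico measurableSet_gapSimplex continuous_lastGap.measurable hweight,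
    ← lintegral_const_mul' _ _ ENNReal.ofReal_ne_top, ← Measure.volume_eq_prod,
    show phasesOfGaps ⁻¹' strictBox 4 = _ from Set.ext phasesOfGaps_mem_strictBox_iff]
  refine lintegral_congr fun p => ?_
  rw [Pi.mul_apply, vanderSq_phasesOfGaps, minGap_phasesOfGaps, div_eq_inv_mul,
    ENNReal.ofReal_mul (by positivity), one_div]
  ring

/-- The density of the smallest gap at `d`, up to normalization: the density of the gaps is
integrated over the configurations whose first gap is `d` and is the smallest one. -/
noncomputable def gapKernel (d : ℝ) : ENNReal :=
  ∫⁻ p in {p | (d, p) ∈ firstMin}, ENNReal.ofReal (gapDensity (d, p))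

theorem smallGap_eq_fst {q : ℝ × ℝ × ℝ} (hq : q ∈ firstMin) : smallGap q = q.1 := by
  obtain ⟨hy, hz, hw⟩ := hq
  rw [smallGap, min_eq_left hy.le, min_eq_left (le_min hz.le hw.le)]

theorem gapSimplex_inter_firstMin : gapSimplex ∩ firstMin = {q | 0 < q.1 ∧ q ∈ firstMin} := by
  ext q
  simp only [gapSimplex, firstMin, Set.mem_inter_iff, Set.mem_ofPred_eq]
  grind

theorem setLIntegral_gapSimplex_inter_firstMin {f : ℝ → ENNReal} (hf : Measurable f) :
    ∫⁻ q in gapSimplex ∩ firstMin, f q.1 * ENNReal.ofReal (gapDensity q) =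
      ∫⁻ d in Set.Ioi 0, f d * gapKernel d := by
  have hslice : ∀ d, MeasurableSet {p | (d, p) ∈ firstMin} := fun d =>
    measurable_prodMk_left measurableSet_firstMin
  have hset := measurableSet_gapSimplex.inter measurableSet_firstMin
  have hmeas : Measurable fun q : ℝ × ℝ × ℝ => f q.1 * ENNReal.ofReal (gapDensity q) := by fun_prop
  rw [← lintegral_indicator hset, Measure.volume_eq_prod,
    lintegral_prod _ (hmeas.indicator hset).aemeasurable,
    gapSimplex_inter_firstMin, ← lintegral_indicator measurableSet_Ioi]
  refine lintegral_congr fun d => ?_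
  by_cases hd : 0 < d
  · rw [Set.indicator_of_mem (Set.mem_Ioi.2 hd), gapKernel, ← lintegral_const_mul _ (by fun_prop),
      ← lintegral_indicator (hslice d)]
    exact lintegral_congr fun p => Set.indicator_eq_indicator (by simp [hd]) rfl
  · simp [hd]

theorem lintegral_sMin_cue {f : ℝ → ENNReal} (hf : Measurable f) :
    ∫⁻ s, f s ∂(cue 4).map (fun U : Matrix.unitaryGroup (Fin 4) ℂ => sMin U.1) =
      ENNReal.ofReal (1 / (2 * Real.pi) ^ 3) *
        ∫⁻ d in Set.Ioi 0, f (d / (Real.pi / 2)) * gapKernel d := by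
  have hg : Measurable fun d : ℝ => f (d / (Real.pi / 2)) := by fun_prop
  have hfirst : ∫⁻ q in gapSimplex ∩ firstMin,
      f (smallGap q / (Real.pi / 2)) * ENNReal.ofReal (gapDensity q) =
      ∫⁻ d in Set.Ioi 0, f (d / (Real.pi / 2)) * gapKernel d := by
    rw [← setLIntegral_gapSimplex_inter_firstMin hg]
    refine setLIntegral_congr_fun (measurableSet_gapSimplex.inter measurableSet_firstMin)
      fun q hq => ?_
    rw [smallGap_eq_fst hq.2]
  rw [map_sMin_cue, lintegral_map hf continuous_minGap.measurable, lintegral_orderedWeyl hf,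
    lintegral_lastGap_mul (by fun_prop) (fun q => by rw [smallGap_rotGap, gapDensity_rotGap]),
    hfirst, ← mul_assoc, ← ENNReal.ofReal_mul (by positivity)]
  congr 2
  field_simp

/-! ### The explicit form of the kernel -/

/-- The factor whose square carries the dependence of the density of the gaps on a gap adjacent to
the first one. The variables `c` and `p` are the cosines of half the first gap and of half the gap
`z` which is two places away from it, and `m` measures the distance from the symmetric position. -/
noncomputable def pairFactor (c p m : ℝ) : ℝ :=
  Real.cos m ^ 2 + 2 * c * p * Real.cos m + (c ^ 2 + p ^ 2 - 1)

/-- The odd primitive of `pairFactor c p ^ 2`. -/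
noncomputable def pairPrimitive (c p m : ℝ) : ℝ :=
  3 / 8 * m + 3 / 8 * (Real.sin m * Real.cos m) + 1 / 4 * (Real.sin m * Real.cos m ^ 3)
    + 4 * c * p * (Real.sin m - 1 / 3 * Real.sin m ^ 3)
    + 1 / 2 * (4 * c ^ 2 * p ^ 2 + 2 * (c ^ 2 + p ^ 2 - 1)) * (m + Real.sin m * Real.cos m)
    + 4 * c * p * (c ^ 2 + p ^ 2 - 1) * Real.sin m + (c ^ 2 + p ^ 2 - 1) ^ 2 * m

theorem pairPrimitive_neg (c p m : ℝ) : pairPrimitive c p (-m) = -pairPrimitive c p m := by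
  rw [pairPrimitive, pairPrimitive, Real.sin_neg, Real.cos_neg]; ring

theorem hasDerivAt_pairPrimitive (c p m : ℝ) :
    HasDerivAt (pairPrimitive c p) (pairFactor c p m ^ 2) m := by
  unfold pairPrimitive pairFactor
  have hm := hasDerivAt_id' m
  have hS := Real.hasDerivAt_sin m
  have hC := Real.hasDerivAt_cos m
  apply HasDerivAt.congr_deriv
  · repeat' first
      | exact hm | exact hS | exact hC
      | apply HasDerivAt.fun_sub | apply HasDerivAt.fun_add | apply HasDerivAt.const_mul
      | apply HasDerivAt.mul_const | apply HasDerivAt.fun_pow | apply HasDerivAt.fun_mul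
  · have h := Real.sin_sq_add_cos_sq m
    simp only [Nat.cast_ofNat, Nat.add_one_sub_one, mul_one]
    linear_combination (-3 / 8 - 3 / 4 * Real.cos m ^ 2 - 4 * c * p * Real.cos m
      - 1 / 2 * (4 * c ^ 2 * p ^ 2 + 2 * (c ^ 2 + p ^ 2 - 1))) * h

@[fun_prop]
theorem continuous_pairPrimitive : Continuous fun q : ℝ × ℝ × ℝ =>
    pairPrimitive q.1 q.2.1 q.2.2 := by
  unfold pairPrimitive
  fun_prop

theorem chord_mul_chord_add (y d : ℝ) :
    chord y * chord (y + d) = 4 * (Real.cos (d / 2) - Real.cos (y + d / 2)) ^ 2 := by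
  have hcos_y : Real.cos y = Real.cos (y + d / 2) * Real.cos (d / 2)
      + Real.sin (y + d / 2) * Real.sin (d / 2) := by
    rw [← Real.cos_sub]; ring_nf
  have hcos_y_add : Real.cos (y + d) = Real.cos (y + d / 2) * Real.cos (d / 2)
      - Real.sin (y + d / 2) * Real.sin (d / 2) := by
    rw [← Real.cos_add]; ring_nf
  rw [chord, chord, hcos_y, hcos_y_add]
  linear_combination -4 * Real.sin (d / 2) ^ 2 * Real.sin_sq_add_cos_sq (y + d / 2)
    + (4 * Real.cos (y + d / 2) ^ 2 - 4) * Real.sin_sq_add_cos_sq (d / 2)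

theorem pairFactor_cos (c b m : ℝ) :
    pairFactor c (Real.cos b) m = (c + Real.cos (m - b)) * (c + Real.cos (m + b)) := by
  rw [pairFactor, Real.cos_sub, Real.cos_add]
  linear_combination Real.sin b ^ 2 * Real.sin_sq_add_cos_sq m
    + (1 - Real.cos m ^ 2) * Real.sin_sq_add_cos_sq b

theorem gapDensity_eq_pairFactor_sq (d y z : ℝ) :
    gapDensity (d, y, z) = 16 * chord d * chord z *
      pairFactor (Real.cos (d / 2)) (Real.cos (z / 2)) (y + (d / 2 + z / 2 - Real.pi)) ^ 2 := by
  have hfactor : pairFactor (Real.cos (d / 2)) (Real.cos (z / 2))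
      (y + (d / 2 + z / 2 - Real.pi)) =
      (Real.cos (d / 2) - Real.cos (y + d / 2)) *
        (Real.cos (d / 2) - Real.cos (y + z + d / 2)) := by
    rw [pairFactor_cos,
      show y + (d / 2 + z / 2 - Real.pi) - z / 2 = y + d / 2 - Real.pi by ring,
      show y + (d / 2 + z / 2 - Real.pi) + z / 2 = y + z + d / 2 - Real.pi by ring,
      Real.cos_sub_pi, Real.cos_sub_pi]
    ring
  calc gapDensity (d, y, z)
      = chord d * chord z * (chord y * chord (y + d)) * (chord (y + z) * chord (y + z + d)) := by
        rw [gapDensity, add_comm d y, show y + d + z = y + z + d by ring]; ring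
    _ = _ := by rw [chord_mul_chord_add, chord_mul_chord_add, hfactor]; ring

theorem chord_eq_sin_sq (t : ℝ) : chord t = 4 * Real.sin (t / 2) ^ 2 := by
  rw [chord, Real.sin_sq, Real.cos_sq]; ring_nf

theorem gapDensity_nonneg (q : ℝ × ℝ × ℝ) : 0 ≤ gapDensity q := by
  simp only [gapDensity, chord_eq_sin_sq]
  positivity

theorem integral_gapDensity (d z : ℝ) :
    ∫ y in d..2 * Real.pi - 2 * d - z, gapDensity (d, y, z) =
      32 * chord d * chord z *
        pairPrimitive (Real.cos (d / 2)) (Real.cos (z / 2)) (Real.pi - 3 * d / 2 - z / 2) := by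
  have hcont : Continuous fun m => pairFactor (Real.cos (d / 2)) (Real.cos (z / 2)) m ^ 2 := by
    unfold pairFactor; fun_prop
  simp only [gapDensity_eq_pairFactor_sq, intervalIntegral.integral_const_mul]
  rw [intervalIntegral.integral_comp_add_right
      fun m => pairFactor (Real.cos (d / 2)) (Real.cos (z / 2)) m ^ 2,
    intervalIntegral.integral_eq_sub_of_hasDerivAt (fun m _ => hasDerivAt_pairPrimitive _ _ m)
      (hcont.intervalIntegrable _ _),
    show d + (d / 2 + z / 2 - Real.pi) = -(Real.pi - 3 * d / 2 - z / 2) by ring,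
    show 2 * Real.pi - 2 * d - z + (d / 2 + z / 2 - Real.pi) = Real.pi - 3 * d / 2 - z / 2 by ring,
    pairPrimitive_neg]
  ring

/-- A polynomial in `c`, `m`, `p = cos x`, `q = sin x`, `S = sin m` and `C = cos m` which is a
primitive of `-(1 - p ^ 2) * pairPrimitive c p m` along the lines on which `m + x` is constant. -/
noncomputable def kernelPoly (c m p q S C : ℝ) : ℝ :=
  (1 / 16 * m ^ 2 + 1 / 6 * m * p ^ 5 * q - 7 / 24 * m * p ^ 3 * q + 1 / 4 * m * p ^ 2 * S * C
    + 1 / 4 * m * p * q * C ^ 2 + 1 / 8 * m * p * q - 1 / 8 * m * S * C - 1 / 36 * p ^ 6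
    - 1 / 6 * p ^ 4 * C ^ 2 + 5 / 32 * p ^ 4 + 1 / 3 * p ^ 3 * q * S * C + 1 / 12 * p ^ 2 * C ^ 4
    + 1 / 48 * p ^ 2 * C ^ 2 - 1 / 6 * p ^ 2 - 1 / 24 * p * q * S * C ^ 3
    - 5 / 24 * p * q * S * C - 7 / 96 * C ^ 4 + 7 / 48 * C ^ 2)
  + c * (-2 / 3 * m * p ^ 3 * S * C ^ 2 + 1 / 6 * m * p ^ 3 * S - 2 / 3 * m * p ^ 2 * q * C ^ 3
    + 1 / 2 * m * p ^ 2 * q * C + 1 / 2 * m * p * S * C ^ 2 + 1 / 6 * m * q * C ^ 3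
    - 1 / 6 * p ^ 5 * C + 5 / 6 * p ^ 4 * q * S + 1 / 9 * p ^ 3 * C ^ 3 + 1 / 8 * p ^ 3 * C
    + 1 / 9 * p ^ 2 * q * S * C ^ 2 - 47 / 72 * p ^ 2 * q * S - 5 / 24 * p * C ^ 3
    + 1 / 24 * p * C + 1 / 72 * q * S * C ^ 2 - 1 / 72 * q * S)
  + c ^ 2 * (m * p ^ 3 * q - 1 / 2 * m * p ^ 2 * S * C - 1 / 2 * m * p * q * C ^ 2
    - 3 / 4 * m * p * q + 1 / 4 * m * S * C - 1 / 3 * p ^ 4 * C ^ 2 - 1 / 12 * p ^ 4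
    + 2 / 3 * p ^ 3 * q * S * C + 11 / 24 * p ^ 2 * C ^ 2 + 13 / 48 * p ^ 2
    - 5 / 24 * p * q * S * C - 23 / 48 * C ^ 2)
  + c ^ 3 * (1 / 2 * m * p * S + 1 / 2 * m * q * C - 1 / 2 * p ^ 3 * C + 3 / 2 * p ^ 2 * q * S
    + 1 / 8 * p * C - 5 / 8 * q * S)
  + c ^ 4 * (1 / 4 * m ^ 2 + 1 / 2 * m * p * q - 1 / 4 * p ^ 2)

theorem hasDerivAt_kernelPoly (c a x : ℝ) :
    HasDerivAt (fun x => kernelPoly c (a - x) (Real.cos x) (Real.sin x) (Real.sin (a - x))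
        (Real.cos (a - x)))
      (-(Real.sin x ^ 2 * pairPrimitive c (Real.cos x) (a - x))) x := by
  have hm : HasDerivAt (fun x => a - x) (-1) x := (hasDerivAt_id' x).const_sub a
  have hS := hm.sin
  have hC := hm.cos
  have hp := Real.hasDerivAt_cos x
  have hq := Real.hasDerivAt_sin x
  unfold kernelPoly pairPrimitive
  apply HasDerivAt.congr_deriv
  · repeat' first
      | exact hm | exact hp | exact hq | exact hS | exact hC
      | apply HasDerivAt.fun_sub | apply HasDerivAt.fun_add | apply HasDerivAt.const_mul
      | apply HasDerivAt.fun_pow | apply HasDerivAt.fun_mul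
  · have hpq := Real.sin_sq_add_cos_sq x
    have hSC := Real.sin_sq_add_cos_sq (a - x)
    rw [Real.sin_sq x]
    clear hm hp hq hS hC
    generalize a - x = m, Real.cos x = p, Real.sin x = q at *
    generalize Real.sin m = S, Real.cos m = C at *
    simp only [Nat.cast_ofNat, Nat.add_one_sub_one]
    linear_combination -((5 / 6 * m * p ^ 4 - 7 / 8 * m * p ^ 2 + 1 / 4 * m * C ^ 2 + 1 / 8 * m
        + p ^ 2 * S * C - 1 / 24 * S * C ^ 3 - 5 / 24 * S * C)
      + c * (-4 / 3 * m * p * C ^ 3 + m * p * C + 10 / 3 * p ^ 3 * S + 2 / 9 * p * S * C ^ 2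
        - 47 / 36 * p * S)
      + c ^ 2 * (3 * m * p ^ 2 - 1 / 2 * m * C ^ 2 - 3 / 4 * m + 2 * p ^ 2 * S * C
        - 5 / 24 * S * C)
      + c ^ 3 * (3 * p * S) + c ^ 4 * (1 / 2 * m)) * hpq
      - ((-1 / 4 * m * p ^ 2 + 1 / 8 * m - 1 / 3 * p ^ 3 * q + 1 / 8 * p * q * C ^ 2
        + 5 / 24 * p * q)
      + c * (4 / 3 * m * p ^ 3 * C - m * p * C - 4 / 3 * p ^ 3 * S - 2 / 9 * p ^ 2 * q * C
        + 4 / 3 * p * S - 1 / 36 * q * C)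
      + c ^ 2 * (1 / 2 * m * p ^ 2 - 1 / 4 * m - 2 / 3 * p ^ 3 * q + 5 / 24 * p * q)) * hSC

theorem integral_sin_sq_mul_pairPrimitive (c a b : ℝ) :
    ∫ x in b..a, Real.sin x ^ 2 * pairPrimitive c (Real.cos x) (a - x) =
      kernelPoly c (a - b) (Real.cos b) (Real.sin b) (Real.sin (a - b)) (Real.cos (a - b))
        - kernelPoly c 0 (Real.cos a) (Real.sin a) 0 1 := by
  have hcont : Continuous fun x => Real.sin x ^ 2 * pairPrimitive c (Real.cos x) (a - x) := by
    fun_prop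
  rw [intervalIntegral.integral_eq_sub_of_hasDerivAt
    (fun x _ => (hasDerivAt_kernelPoly c a x).neg.congr_deriv (neg_neg _))
    (hcont.intervalIntegrable _ _)]
  simp only [Pi.neg_apply, sub_self, Real.sin_zero, Real.cos_zero]
  ring

theorem integral_integral_gapDensity (τ : ℝ) :
    ∫ z in 2 * τ..2 * Real.pi - 3 * (2 * τ),
      ∫ y in 2 * τ..2 * Real.pi - 2 * (2 * τ) - z, gapDensity (2 * τ, y, z) =
      1024 * Real.sin τ ^ 2 *
        (kernelPoly (Real.cos τ) (Real.pi - 4 * τ) (Real.cos τ) (Real.sin τ)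
            (Real.sin (4 * τ)) (-Real.cos (4 * τ))
          - kernelPoly (Real.cos τ) 0 (-Real.cos (3 * τ)) (Real.sin (3 * τ)) 0 1) := by
  have hintegrand : ∀ z : ℝ, ∫ y in 2 * τ..2 * Real.pi - 2 * (2 * τ) - z, gapDensity (2 * τ, y, z) =
      512 * Real.sin τ ^ 2 * (fun x => Real.sin x ^ 2 *
        pairPrimitive (Real.cos τ) (Real.cos x) (Real.pi - 3 * τ - x)) (z / 2) := fun z => by
    rw [integral_gapDensity, chord_eq_sin_sq, chord_eq_sin_sq, mul_div_cancel_left₀ τ two_ne_zero,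
      show Real.pi - 3 * (2 * τ) / 2 - z / 2 = Real.pi - 3 * τ - z / 2 by ring]
    ring
  simp only [hintegrand, intervalIntegral.integral_const_mul]
  rw [intervalIntegral.integral_comp_div (fun x => Real.sin x ^ 2 *
      pairPrimitive (Real.cos τ) (Real.cos x) (Real.pi - 3 * τ - x)) two_ne_zero,
    mul_div_cancel_left₀ τ two_ne_zero,
    show (2 * Real.pi - 3 * (2 * τ)) / 2 = Real.pi - 3 * τ by ring,
    integral_sin_sq_mul_pairPrimitive, show Real.pi - 3 * τ - τ = Real.pi - 4 * τ by ring,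
    Real.cos_pi_sub, Real.sin_pi_sub, Real.cos_pi_sub, Real.sin_pi_sub, smul_eq_mul]
  ring

/-! ### The trigonometric sums in the density -/

theorem cos_add_two_mul (a x : ℝ) :
    Real.cos ((a + 2) * x) = 2 * Real.cos x * Real.cos ((a + 1) * x) - Real.cos (a * x) := by
  rw [Real.two_mul_cos_mul_cos, ← Real.cos_neg (x - _)]
  ring_nf

theorem sin_add_two_mul (a x : ℝ) :
    Real.sin ((a + 2) * x) = 2 * Real.cos x * Real.sin ((a + 1) * x) - Real.sin (a * x) := by
  rw [mul_right_comm, Real.two_mul_sin_mul_cos]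
  ring_nf

theorem cos_sum_eq (x : ℝ) :
    -100 * Real.cos (3 * x) - 608 * Real.cos (4 * x) - 380 * Real.cos (5 * x)
        + 234 * Real.cos (6 * x) + 74 * Real.cos (7 * x) - 58 * Real.cos (8 * x)
        + 10 * Real.cos (9 * x) =
      2560 * Real.cos x ^ 9 - 7424 * Real.cos x ^ 8 - 1024 * Real.cos x ^ 7
        + 22336 * Real.cos x ^ 6 - 10048 * Real.cos x ^ 5 - 25376 * Real.cos x ^ 4
        + 10144 * Real.cos x ^ 3 + 10932 * Real.cos x ^ 2 - 2028 * Real.cos x - 900 := by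
  have h3 := cos_add_two_mul 1 x
  have h4 := cos_add_two_mul 2 x
  have h5 := cos_add_two_mul 3 x
  have h6 := cos_add_two_mul 4 x
  have h7 := cos_add_two_mul 5 x
  have h8 := cos_add_two_mul 6 x
  have h9 := cos_add_two_mul 7 x
  norm_num1 at h3 h4 h5 h6 h7 h8 h9
  rw [h9, h8, h7, h6, h5, h4, h3, Real.cos_two_mul, one_mul]
  ring

theorem sin_sum_eq (x : ℝ) :
    60 * Real.sin x + 63 * Real.sin (2 * x) + 22 * Real.sin (3 * x) + 2 * Real.sin (4 * x)
        - 4 * Real.sin (5 * x) =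
      Real.sin x * (34 + 118 * Real.cos x + 136 * Real.cos x ^ 2 + 16 * Real.cos x ^ 3
        - 64 * Real.cos x ^ 4) := by
  have h3 := sin_add_two_mul 1 x
  have h4 := sin_add_two_mul 2 x
  have h5 := sin_add_two_mul 3 x
  norm_num1 at h3 h4 h5
  rw [h5, h4, h3, Real.sin_two_mul, one_mul]
  ring

theorem trigSum_eq_kernelPoly (L τ : ℝ) :
    666 + 720 * L ^ 2 + 36 * (11 + 16 * L ^ 2) * Real.cos (2 * τ)
        + 18 * (8 * L ^ 2 - 13) * Real.cos (2 * (2 * τ))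
        + (-100 * Real.cos (3 * (2 * τ)) - 608 * Real.cos (4 * (2 * τ))
          - 380 * Real.cos (5 * (2 * τ)) + 234 * Real.cos (6 * (2 * τ))
          + 74 * Real.cos (7 * (2 * τ)) - 58 * Real.cos (8 * (2 * τ))
          + 10 * Real.cos (9 * (2 * τ)))
        + 24 * L * (60 * Real.sin (2 * τ) + 63 * Real.sin (2 * (2 * τ))
          + 22 * Real.sin (3 * (2 * τ)) + 2 * Real.sin (4 * (2 * τ))
          - 4 * Real.sin (5 * (2 * τ))) =
      4608 * (kernelPoly (Real.cos τ) L (Real.cos τ) (Real.sin τ)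
          (Real.sin (4 * τ)) (-Real.cos (4 * τ))
        - kernelPoly (Real.cos τ) 0 (-Real.cos (3 * τ)) (Real.sin (3 * τ)) 0 1) := by
  have h := Real.sin_sq_add_cos_sq τ
  rw [cos_sum_eq, sin_sum_eq, show 4 * τ = 2 * (2 * τ) by ring, Real.cos_two_mul (2 * τ),
    Real.sin_two_mul (2 * τ), Real.cos_two_mul, Real.sin_two_mul, Real.cos_three_mul,
    Real.sin_three_mul]
  unfold kernelPoly
  generalize Real.cos τ = c, Real.sin τ = r at h ⊢
  linear_combination (-786432 * c ^ 16 + 2490368 * c ^ 14 - 3014656 * c ^ 12 + 1937408 * c ^ 10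
    - 944128 * c ^ 8 + 387584 * c ^ 6 - 86272 * c ^ 4 + 4608 * c ^ 2) * h

theorem integral_integral_gapDensity_eq_densityCUE4 (s : ℝ) :
    ∫ z in Real.pi / 2 * s..2 * Real.pi - 3 * (Real.pi / 2 * s),
      ∫ y in Real.pi / 2 * s..2 * Real.pi - 2 * (Real.pi / 2 * s) - z,
        gapDensity (Real.pi / 2 * s, y, z) = 16 * Real.pi ^ 2 * densityCUE4 s := by
  obtain ⟨τ, hτ⟩ : ∃ τ, τ = Real.pi * s / 4 := ⟨_, rfl⟩
  have hL : Real.pi - 4 * τ = Real.pi * (1 - s) := by rw [hτ]; ring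
  have hconst : 16 * Real.pi ^ 2 * (1 / (72 * Real.pi ^ 2)) = 2 / 9 := by
    field_simp; norm_num
  have htrig := trigSum_eq_kernelPoly (Real.pi * (1 - s)) τ
  rw [show Real.pi / 2 * s = 2 * τ by rw [hτ]; ring, integral_integral_gapDensity, hL, densityCUE4,
    ← hτ, show Real.pi * s / 2 = 2 * τ by rw [hτ]; ring,
    show Real.pi * s = 2 * (2 * τ) by rw [hτ]; ring,
    show 3 * Real.pi * s / 2 = 3 * (2 * τ) by rw [hτ]; ring,
    show 2 * Real.pi * s = 4 * (2 * τ) by rw [hτ]; ring,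
    show 5 * Real.pi * s / 2 = 5 * (2 * τ) by rw [hτ]; ring,
    show 3 * Real.pi * s = 6 * (2 * τ) by rw [hτ]; ring,
    show 7 * Real.pi * s / 2 = 7 * (2 * τ) by rw [hτ]; ring,
    show 4 * Real.pi * s = 8 * (2 * τ) by rw [hτ]; ring,
    show 9 * Real.pi * s / 2 = 9 * (2 * τ) by rw [hτ]; ring]
  rw [mul_assoc (1 / _), ← mul_assoc, hconst]
  linear_combination -(2 / 9) * Real.sin τ ^ 2 * htrig

theorem integral_integral_gapDensity_nonneg {d : ℝ} (hd : d ≤ Real.pi / 2) :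
    0 ≤ ∫ z in d..2 * Real.pi - 3 * d, ∫ y in d..2 * Real.pi - 2 * d - z, gapDensity (d, y, z) :=
  intervalIntegral.integral_nonneg (by linarith) fun z hz =>
    intervalIntegral.integral_nonneg (by linarith [hz.2]) fun _ _ => gapDensity_nonneg _

theorem densityCUE4_nonneg {s : ℝ} (hs : s ≤ 1) : 0 ≤ densityCUE4 s := by
  have h := integral_integral_gapDensity_nonneg (d := Real.pi / 2 * s)
    (by nlinarith [Real.pi_pos])
  rw [integral_integral_gapDensity_eq_densityCUE4] at h
  exact nonneg_of_mul_nonneg_right h (by positivity)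

theorem densityCUE4_zero : densityCUE4 0 = 0 := by simp [densityCUE4]

theorem densityCUE4_one : densityCUE4 1 = 0 := by
  have h := integral_integral_gapDensity_eq_densityCUE4 1
  rw [show 2 * Real.pi - 3 * (Real.pi / 2 * 1) = Real.pi / 2 * 1 by ring,
    intervalIntegral.integral_same] at h
  exact (mul_eq_zero.1 h.symm).resolve_left (by positivity)

theorem continuous_densityCUE4 : Continuous densityCUE4 := by
  unfold densityCUE4
  fun_prop

theorem lintegral_Ioo_ofReal {f : ℝ → ℝ} (hf : Continuous f) {a b : ℝ} (hab : a ≤ b)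
    (h0 : ∀ x ∈ Set.Ioo a b, 0 ≤ f x) :
    ∫⁻ x in Set.Ioo a b, ENNReal.ofReal (f x) = ENNReal.ofReal (∫ x in a..b, f x) := by
  rw [intervalIntegral.integral_of_le hab, integral_Ioc_eq_integral_Ioo,
    ofReal_integral_eq_lintegral_ofReal]
  · exact (hf.integrableOn_Icc).mono_set Set.Ioo_subset_Icc_self
  · exact (ae_restrict_iff' measurableSet_Ioo).2 (Filter.Eventually.of_forall h0)

theorem setLIntegral_triangle_ofReal {h : ℝ × ℝ → ℝ} (hh : Continuous h) (h0 : ∀ p, 0 ≤ h p)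
    {d c : ℝ} (hdc : 2 * d ≤ c) :
    ∫⁻ p in {p | d < p.1 ∧ d < p.2 ∧ p.1 + p.2 < c}, ENNReal.ofReal (h p) =
      ENNReal.ofReal (∫ z in d..c - d, ∫ y in d..c - z, h (y, z)) := by
  have hset : MeasurableSet {p : ℝ × ℝ | d < p.1 ∧ d < p.2 ∧ p.1 + p.2 < c} := by
    refine IsOpen.measurableSet ?_
    simp only [Set.ofPred_and]
    repeat' first | apply IsOpen.inter | exact isOpen_lt (by fun_prop) (by fun_prop)
  have hinner : Continuous fun z => ∫ y in d..c - z, h (y, z) :=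
    intervalIntegral.continuous_parametric_intervalIntegral_of_continuous
      (f := fun z y => h (y, z)) (by unfold Function.uncurry; fun_prop) (by fun_prop)
  rw [← lintegral_indicator hset, Measure.volume_eq_prod,
    lintegral_prod_symm' _ (hh.measurable.ennreal_ofReal.indicator hset),
    ← lintegral_Ioo_ofReal hinner (by linarith) fun z hz =>
      intervalIntegral.integral_nonneg (by linarith [hz.2]) fun _ _ => h0 _,
    ← lintegral_indicator measurableSet_Ioo]
  refine lintegral_congr fun z => ?_
  by_cases hz : z ∈ Set.Ioo d (c - d)
  · rw [Set.indicator_of_mem hz, ← lintegral_Ioo_ofReal (f := fun y => h (y, z)) (by fun_prop)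
      (by linarith [hz.2]) fun _ _ => h0 _, ← lintegral_indicator measurableSet_Ioo]
    exact lintegral_congr fun y => Set.indicator_eq_indicator
      (by simp [hz.1, lt_sub_iff_add_lt]) rfl
  · rw [Set.indicator_of_notMem hz]
    refine (lintegral_congr fun y => Set.indicator_of_notMem ?_ _).trans lintegral_zero
    rintro ⟨hy, hz', hyz⟩
    exact hz ⟨hz', by linarith⟩

theorem gapKernel_eq_ofReal {d : ℝ} (hd : d ≤ Real.pi / 2) :
    gapKernel d = ENNReal.ofReal (∫ z in d..2 * Real.pi - 3 * d,
      ∫ y in d..2 * Real.pi - 2 * d - z, gapDensity (d, y, z)) := by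
  have htriangle : {p | (d, p) ∈ firstMin} =
      {p : ℝ × ℝ | d < p.1 ∧ d < p.2 ∧ p.1 + p.2 < 2 * Real.pi - 2 * d} := by
    ext p
    simp only [firstMin, lastGap, Set.mem_ofPred_eq]
    grind
  rw [gapKernel, htriangle, setLIntegral_triangle_ofReal (by fun_prop)
    (fun _ => gapDensity_nonneg _) (by linarith),
    show 2 * Real.pi - 2 * d - d = 2 * Real.pi - 3 * d by ring]

theorem gapKernel_eq_zero {d : ℝ} (hd : Real.pi / 2 ≤ d) : gapKernel d = 0 := by
  have hempty : {p | (d, p) ∈ firstMin} = ∅ := by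
    ext p
    simp only [firstMin, lastGap, Set.mem_ofPred_eq, Set.mem_empty_iff_false, iff_false]
    grind
  rw [gapKernel, hempty, Measure.restrict_empty, lintegral_zero_measure]

theorem gapKernel_pi_div_two_mul (s : ℝ) :
    gapKernel (Real.pi / 2 * s) = (Set.Iic 1).indicator
      (fun s => ENNReal.ofReal (16 * Real.pi ^ 2 * densityCUE4 s)) s := by
  rcases le_or_gt s 1 with hs | hs
  · rw [Set.indicator_of_mem (Set.mem_Iic.2 hs), gapKernel_eq_ofReal (by nlinarith [Real.pi_pos]),
      integral_integral_gapDensity_eq_densityCUE4]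
  · rw [Set.indicator_of_notMem (Set.notMem_Iic.2 hs),
      gapKernel_eq_zero (by nlinarith [Real.pi_pos])]

/-! ### The law of the minimal spacing -/

theorem setLIntegral_Ioi_zero_eq_comp_mul_left (f : ℝ → ENNReal) {a : ℝ} (ha : 0 < a) :
    ∫⁻ x in Set.Ioi 0, f x = ENNReal.ofReal a * ∫⁻ x in Set.Ioi 0, f (a * x) := by
  have hemb : MeasurableEmbedding (a * ·) :=
    (Homeomorph.mulLeft₀ a ha.ne').measurableEmbedding
  have hpre : (a * ·) ⁻¹' Set.Ioi 0 = Set.Ioi (0 : ℝ) := by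
    ext x; simp [ha]
  calc ∫⁻ x in Set.Ioi 0, f x
      = ∫⁻ x in Set.Ioi 0, f x ∂(ENNReal.ofReal |a| • volume.map (a * ·)) := by
        rw [Real.smul_map_volume_mul_left ha.ne']
    _ = _ := by
        rw [Measure.restrict_smul, lintegral_smul_measure, hemb.restrict_map, hemb.lintegral_map,
          hpre, abs_of_pos ha, smul_eq_mul]

theorem map_sMin_eq_withDensity :
    (cue 4).map (fun U : Matrix.unitaryGroup (Fin 4) ℂ => sMin U.1) =
      (volume.restrict (Set.Icc 0 1)).withDensity fun s => ENNReal.ofReal (densityCUE4 s) := by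
  have hpi := Real.pi_pos
  have hρ : Measurable fun s => ENNReal.ofReal (densityCUE4 s) :=
    continuous_densityCUE4.measurable.ennreal_ofReal
  refine Measure.ext_of_lintegral _ fun f hf => ?_
  calc ∫⁻ s, f s ∂(cue 4).map (fun U : Matrix.unitaryGroup (Fin 4) ℂ => sMin U.1)
      = ENNReal.ofReal (1 / (16 * Real.pi ^ 2)) *
          ∫⁻ s in Set.Ioi 0, f s * gapKernel (Real.pi / 2 * s) := by
        rw [lintegral_sMin_cue hf, setLIntegral_Ioi_zero_eq_comp_mul_left _ (half_pos hpi),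
          ← mul_assoc, ← ENNReal.ofReal_mul (by positivity)]
        simp only [mul_div_cancel_left₀ _ (half_pos hpi).ne']
        congr 2
        field_simp
        norm_num
    _ = ∫⁻ s in Set.Ioi 0, (Set.Iic 1).indicator
          (fun s => ENNReal.ofReal (densityCUE4 s) * f s) s := by
        rw [← lintegral_const_mul' _ _ ENNReal.ofReal_ne_top]
        refine lintegral_congr fun s => ?_
        rw [gapKernel_pi_div_two_mul]
        by_cases hs : s ∈ Set.Iic 1
        · rw [Set.indicator_of_mem hs, Set.indicator_of_mem hs, mul_left_comm,
            ← ENNReal.ofReal_mul (by positivity), ← mul_assoc,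
            one_div_mul_cancel (by positivity), one_mul, mul_comm]
        · rw [Set.indicator_of_notMem hs, Set.indicator_of_notMem hs, mul_zero, mul_zero]
    _ = _ := by
        rw [setLIntegral_indicator measurableSet_Iic, Set.inter_comm, Set.Ioi_inter_Iic,
          restrict_Ioc_eq_restrict_Icc, lintegral_withDensity_eq_lintegral_mul _ hρ hf]
        simp only [Pi.mul_apply]

theorem hasDerivAt_real_Ioi_withDensity {ρ : ℝ → ℝ} (hcont : Continuous ρ) (hint : Integrable ρ)
    (h0 : ∀ x, 0 ≤ ρ x) (t : ℝ) :
    HasDerivAt (fun u => (volume.withDensity fun x => ENNReal.ofReal (ρ x)).real (Set.Ioi u))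
      (-ρ t) t := by
  have htail : (fun u => (volume.withDensity fun x => ENNReal.ofReal (ρ x)).real (Set.Ioi u)) =
      fun u => (∫ x in u..t, ρ x) + ∫ x in Set.Ioi t, ρ x := by
    funext u
    rw [intervalIntegral.integral_interval_add_Ioi hint.integrableOn hint.integrableOn,
      measureReal_def, withDensity_apply _ measurableSet_Ioi,
      ← ofReal_integral_eq_lintegral_ofReal hint.integrableOn (ae_of_all _ h0),
      ENNReal.toReal_ofReal (integral_nonneg h0)]
  rw [htail]
  exact (intervalIntegral.integral_hasDerivAt_left (hcont.intervalIntegrable t t)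
    hcont.aestronglyMeasurable.stronglyMeasurableAtFilter hcont.continuousAt).add_const _

theorem hasDerivAt_tail {t : ℝ} (ht : t ∈ Set.Icc (0 : ℝ) 1) :
    HasDerivAt (fun t : ℝ => (cue 4).real {U : Matrix.unitaryGroup (Fin 4) ℂ | t < sMin U.1})
      (-densityCUE4 t) t := by
  have hcont : Continuous ((Set.Icc 0 1).indicator densityCUE4) :=
    continuous_densityCUE4.indicator fun s hs => by
      rw [frontier_Icc zero_le_one] at hs
      rcases hs with rfl | rfl
      exacts [densityCUE4_zero, densityCUE4_one]
  have hint : Integrable ((Set.Icc 0 1).indicator densityCUE4) :=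
    (integrable_indicator_iff measurableSet_Icc).2 continuous_densityCUE4.integrableOn_Icc
  have h := hasDerivAt_real_Ioi_withDensity hcont hint
    (Set.indicator_nonneg fun s hs => densityCUE4_nonneg hs.2) t
  have hlaw : (volume.withDensity fun s =>
      ENNReal.ofReal ((Set.Icc (0 : ℝ) 1).indicator densityCUE4 s)) =
      (cue 4).map (fun U : Matrix.unitaryGroup (Fin 4) ℂ => sMin U.1) := by
    rw [map_sMin_eq_withDensity, ← withDensity_indicator measurableSet_Icc]
    congr 1
    exact (Set.indicator_comp_of_zero ENNReal.ofReal_zero).symm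
  rw [Set.indicator_of_mem ht, hlaw] at h
  simp only [map_measureReal_apply measurable_sMin measurableSet_Ioi] at h
  exact h

end CUESpacing

theorem mainTheorem1 :
    -- `s_min` is a random variable whose law has the density `densityCUE4` on `[0, 1]`
    (AEMeasurable (fun U : Matrix.unitaryGroup (Fin 4) ℂ => CUESpacing.sMin U.1)
        (CUESpacing.cue 4) ∧
      (CUESpacing.cue 4).map (fun U : Matrix.unitaryGroup (Fin 4) ℂ => CUESpacing.sMin U.1) =
        (volume.restrict (Set.Icc (0 : ℝ) 1)).withDensity
          (fun s => ENNReal.ofReal (CUESpacing.densityCUE4 s))) ∧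
    -- `densityCUE4` is nonnegative and is minus the derivative of the tail `T(t) = P(s_min > t)`
    ∀ t ∈ Set.Icc (0 : ℝ) 1,
      0 ≤ CUESpacing.densityCUE4 t ∧
      HasDerivAt
        (fun t : ℝ => (CUESpacing.cue 4).real
          {U : Matrix.unitaryGroup (Fin 4) ℂ | t < CUESpacing.sMin U.1})
        (-CUESpacing.densityCUE4 t) t :=
  ⟨⟨CUESpacing.measurable_sMin.aemeasurable, CUESpacing.map_sMin_eq_withDensity⟩,
    fun _ ht => ⟨CUESpacing.densityCUE4_nonneg ht.2, CUESpacing.hasDerivAt_tail ht⟩⟩
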